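/- Let $n\ge 1$ be an integer and let $q\in[0,n)$ be real with $n+q>2$. Write $B_1$ for the open unit ball of $\mathbb{R}^n$, and regard $\mathbb{R}^k\subset\mathbb{R}^n$ as the coordinate subspace where all but the first $k$ coordinates vanish. For every positive integer $k<\frac{n+q}{2}$ and every real $s\in\left[1,\frac{2n-2k}{n-q}\right]$ there is a convex function $v\ge 0$ on $B_1$ that satisfies $$\det D^2v=v^q\chi_{\{v>0\}}\quad\text{in } B_1$$ in the sense of Aleksandrov (that is, $|\partial v(A)|=\int_A v^q\chi_{\{v>0\}}\,dx$ for every Borel set $A\subset B_1$, where $\partial v(A)$ is the union of the subdifferentials of $v$ at the points of $A$), whose coincidence set is $$K:=\{x\in B_1: v(x)=0\}=\mathbb{R}^k\cap B_1,$$ and for which there are constants $c,C>0$ with $$c\,\operatorname{dist}(x,\mathbb{R}^k)^s\le v(x)\le C\,\operatorname{dist}(x,\mathbb{R}^k)^s\quad\text{for all } x\in B_1 .$$ Moreover, $v$ may be chosen so that it extends continuously to $\overline{B_1}$, and then it shows the sharpness of the bounds $\dim E<\frac{n+q}{2}$ and $\dim E\le n-\frac{(n-q)s}{2}$ for convex subsets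 $E$ of $\Gamma_{nsc}$, the set of points of $B_1\cap\partial K$ that are not exposed points of $K$ (the second bound being for $s>1$ and for $v$ with growth of order $s$ on $\partial B_1$ at a point of $\overline{E}\cap\partial B_1$). Precisely, $E=K$ is a convex subset of $\Gamma_{nsc}$ of dimension $k$, the set $\overline{K}\cap\partial B_1$ is non-empty, and for every $x_0\in\overline{K}\cap\partial B_1$ there is $C'>0$ with $v(x)\le C'|x-x_0|^s$ for all $x\in\partial B_1$. -/

import Mathlib

open MeasureTheory
open scoped RealInnerProductSpace

noncomputable section

/-- The subdifferential `∂v(x)` of `v : Ω → ℝ` at `x`: all slopes of affine functions that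
touch the graph of `v` at `x` and stay below it in `Ω`. -/
def subdifferential {n : ℕ} (Ω : Set (EuclideanSpace ℝ (Fin n)))
    (v : EuclideanSpace ℝ (Fin n) → ℝ) (x : EuclideanSpace ℝ (Fin n)) :
    Set (EuclideanSpace ℝ (Fin n)) :=
  {p | ∀ y ∈ Ω, v x + ⟪p, y - x⟫ ≤ v y}

/-- The Monge–Ampère measure `|∂v(A)|` of a set `A`: the Lebesgue measure of the union of the
subdifferentials of `v` at the points of `A`. -/
def mongeAmpereMeasure {n : ℕ} (Ω : Set (EuclideanSpace ℝ (Fin n)))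
    (v : EuclideanSpace ℝ (Fin n) → ℝ) (A : Set (EuclideanSpace ℝ (Fin n))) : ENNReal :=
  volume (⋃ x ∈ A, subdifferential Ω v x)

/-- `v` is a convex nonnegative solution of `det D²v = v ^ q χ_{v > 0}` in `Ω` in the sense of
Aleksandrov: its Monge–Ampère measure has density `v ^ q χ_{v > 0}` in `Ω`. Only the values of
`v` in `Ω` matter. -/
structure IsObstacleSolution {n : ℕ} (q : ℝ) (Ω : Set (EuclideanSpace ℝ (Fin n)))
    (v : EuclideanSpace ℝ (Fin n) → ℝ) : Prop where
  convexOn : ConvexOn ℝ Ω v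
  nonneg : ∀ x ∈ Ω, 0 ≤ v x
  det_eq : ∀ A : Set (EuclideanSpace ℝ (Fin n)), MeasurableSet A → A ⊆ Ω →
    mongeAmpereMeasure Ω v A =
      ∫⁻ x in A, {x | 0 < v x}.indicator (fun x => ENNReal.ofReal (v x ^ q)) x

/-- The coincidence set `K = {x ∈ Ω : v x = 0}`. -/
def coincidenceSet {n : ℕ} (Ω : Set (EuclideanSpace ℝ (Fin n)))
    (v : EuclideanSpace ℝ (Fin n) → ℝ) : Set (EuclideanSpace ℝ (Fin n)) :=
  {x | x ∈ Ω ∧ v x = 0}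

/-- The non-strictly convex part of the free boundary `Ω ∩ ∂K`: the free boundary points that
are not exposed points of the coincidence set `K`. -/
def nonStrictlyConvexPart {n : ℕ} (Ω : Set (EuclideanSpace ℝ (Fin n)))
    (v : EuclideanSpace ℝ (Fin n) → ℝ) : Set (EuclideanSpace ℝ (Fin n)) :=
  (Ω ∩ frontier (coincidenceSet Ω v)) \ (coincidenceSet Ω v).exposedPoints ℝ

/-- The coordinate subspace `ℝᵏ ⊆ ℝⁿ` on which all coordinates after the first `k` vanish. -/
def coordSubspace (n k : ℕ) : Submodule ℝ (EuclideanSpace ℝ (Fin n)) where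
  carrier := {x | ∀ i : Fin n, k ≤ (i : ℕ) → x i = 0}
  add_mem' := by
    intro x y hx hy i hi
    simp [hx i hi, hy i hi]
  zero_mem' := by
    intro i _
    simp
  smul_mem' := by
    intro a x hx i hi
    simp [hx i hi]

end

/-!
# An obstacle solution whose coincidence set is a flat disc

Write `t = dist (x, ℝᵏ)`. The solution `v` is trapped between two multiples of `t ^ s`, from which
every assertion about the coincidence set and about growth can be read off; see
`exists_solution_between`.

*Upper bound.* `v` solves a Dirichlet problem with boundary values `φ = 2 A t ^ s`. A convex
function is at most its boundary values along a chord parallel to `ℝᵏ`, and `t` is constant on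
such a chord, so `v ≤ 2 A t ^ s` in the ball.

*Lower bound.* With `r` the norm of the projection to `ℝᵏ`, the function
`w = t ^ s + t ^ σ (2 - r ²) ^ (1 - σ)` (`modelFn`) is strictly convex off `ℝᵏ`
(`modelFn_tangent_lt`), and its Hessian
determinant is at least a multiple of `t` to the power `σ (k - 1) + (s - 2) (n - k - 1) + 2 σ - 2`
(`exists_hasFDerivAt_le_det`). The exponent `σ` is chosen so that this power is `s q`; the
hypotheses `k < (n + q) / 2` and `s ≤ (2 n - 2 k) / (n - q)` ensure that `σ > 1` and `σ ≥ s`. As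
the determinant is homogeneous of degree `n > q`, for large `A` the function `A w` satisfies
`det D² (A w) ≥ 2 (A w) ^ q` (`exists_modelFn_subsolution`). The equation is solved with right-hand
side `max (v, A w) ^ q`; where `v < A w` this is `(A w) ^ q`, and the comparison principle
`le_of_strict_subsolution` shows that this never happens. Hence `v ≥ A w`, the truncation is
inactive, and `v` solves the original equation.

*Existence.* It remains to solve `det D² v = f (x, v)` in the Aleksandrov sense for continuous
bounded `f ≥ 0` that need not be monotone in `v` (`exists_mongeAmpereMeasure_eq`). The
construction works on the dual side. Heights `H` prescribed on the unit sphere and at finitely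
many interior nodes cut the space of slopes into Laguerre cells, the cell of a node being the
subdifferential there of the largest convex function below `H`. Among the heights whose cells have
at least the prescribed volumes, those with maximal sum have exactly these volumes
(`exists_volume_cell_eq`): raising one height shrinks its own cell continuously and enlarges the
others. The Legendre transforms of the heights are convex with slopes in the unit ball, so a
subsequence converges to some `g` (`exists_subseq_tendsto`). The Monge–Ampère measure of the
Legendre transform `v` of `g` is the push-forward of Lebesgue measure under `∇ g`
(`mongeAmpereMeasure_legendre`), so convergence of gradients almost everywhere yields the equation
(`integral_comp_gradient_eq_of_tendsto`). Boundary values persist because a height far below a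
supporting affine function near the sphere forces the cells to cover a set of large volume
(`exists_barrier`).
-/

open Set Filter Topology Metric Gradient

/-! ### Subgradients, Legendre transforms and Laguerre cells -/

section Duality

variable {V : Type*} [NormedAddCommGroup V] [InnerProductSpace ℝ V]

/-- `z` is a subgradient of `g : V → ℝ` at `p`. -/
def IsSubgradient (g : V → ℝ) (p z : V) : Prop := ∀ p', g p + ⟪z, p' - p⟫ ≤ g p'

/-- The Legendre transform of `H : V → ℝ` restricted to `Z`: the supremum of the affine functions
`p ↦ ⟪p, z⟫ - H z` over `z ∈ Z`. It is used only where this supremum is finite. -/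
noncomputable def legendre (Z : Set V) (H : V → ℝ) (p : V) : ℝ :=
  sSup ((fun z => ⟪p, z⟫ - H z) '' Z)

/-- The Laguerre cell of `z`: the slopes `p` for which `z` maximizes `⟪p, z⟫ - H z` over `Z`.
For `z ∈ Z` these are the slopes of the affine functions below `H` on `Z` that touch `H` at `z`. -/
def cell (Z : Set V) (H : V → ℝ) (z : V) : Set V :=
  {p | ∀ z' ∈ Z, ⟪p, z'⟫ - H z' ≤ ⟪p, z⟫ - H z}

variable {Z : Set V} {H g : V → ℝ} {p z : V}

lemma legendre_eq_of_mem_cell (hz : z ∈ Z) (hp : p ∈ cell Z H z) :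
    legendre Z H p = ⟪p, z⟫ - H z :=
  IsGreatest.csSup_eq ⟨⟨z, hz, rfl⟩, by rintro _ ⟨z', hz', rfl⟩; exact hp z' hz'⟩

lemma isSubgradient_legendre (hZ : ∀ p, ∃ z ∈ Z, p ∈ cell Z H z) (hz : z ∈ Z)
    (hp : p ∈ cell Z H z) : IsSubgradient (legendre Z H) p z := by
  intro p'
  obtain ⟨z', hz', hp'⟩ := hZ p'
  rw [legendre_eq_of_mem_cell hz hp, legendre_eq_of_mem_cell hz' hp']
  have := hp' z hz
  rw [inner_sub_right, real_inner_comm p' z, real_inner_comm p z]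
  linarith

lemma isClosed_cell (Z : Set V) (H : V → ℝ) (z : V) : IsClosed (cell Z H z) := by
  have : cell Z H z = ⋂ z' ∈ Z, {p | ⟪p, z'⟫ - H z' ≤ ⟪p, z⟫ - H z} := by
    ext p; simp [cell]
  rw [this]
  exact isClosed_biInter fun z' _ => isClosed_le (by fun_prop) (by fun_prop)

lemma lipschitzWith_of_isSubgradient (hg : ∀ p, ∃ z, ‖z‖ ≤ 1 ∧ IsSubgradient g p z) :
    LipschitzWith 1 g := by
  have key : ∀ p p', g p - g p' ≤ ‖p - p'‖ := by
    intro p p'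
    obtain ⟨z, hz, h⟩ := hg p
    have h1 := h p'
    have h2 := (abs_le.1 (abs_real_inner_le_norm z (p' - p))).1
    rw [norm_sub_rev p' p] at h2
    have h3 := mul_le_mul_of_nonneg_right hz (norm_nonneg (p - p'))
    linarith
  refine LipschitzWith.of_dist_le_mul fun p p' => ?_
  rw [Real.dist_eq, dist_eq_norm, NNReal.coe_one, one_mul, abs_le]
  have h1 := key p p'
  have h2 := key p' p
  rw [norm_sub_rev] at h2
  constructor <;> linarith

lemma ae_differentiableAt_of_isSubgradient [FiniteDimensional ℝ V] [MeasurableSpace V]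
    [BorelSpace V]
    (hg : ∀ p, ∃ z, ‖z‖ ≤ 1 ∧ IsSubgradient g p z) : ∀ᵐ p, DifferentiableAt ℝ g p :=
  (lipschitzWith_of_isSubgradient hg).ae_differentiableAt

variable [CompleteSpace V]

lemma gradient_eq_of_isSubgradient (hd : DifferentiableAt ℝ g p) (h : IsSubgradient g p z) :
    ∇ g p = z := by
  apply HasGradientAt.gradient
  rw [hasGradientAt_iff_hasFDerivAt]
  have hmin : IsLocalMin (fun p' => g p' - ⟪z, p'⟫) p := by
    refine Eventually.of_forall fun p' => ?_
    have := h p'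
    rw [inner_sub_right] at this
    linarith
  have hd' := hd.hasFDerivAt.sub ((InnerProductSpace.toDual ℝ V) z).hasFDerivAt (x := p)
  have := hmin.hasFDerivAt_eq_zero hd'
  rw [sub_eq_zero] at this
  rw [← this]
  exact hd.hasFDerivAt

lemma isSubgradient_gradient (hd : DifferentiableAt ℝ g p) (h : ∃ z, IsSubgradient g p z) :
    IsSubgradient g p (∇ g p) := by
  obtain ⟨z, hz⟩ := h
  rwa [gradient_eq_of_isSubgradient hd hz]

variable [MeasurableSpace V] [BorelSpace V]

lemma measurable_gradient (g : V → ℝ) : Measurable (∇ g) := by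
  unfold gradient
  exact (LinearIsometryEquiv.continuous _).measurable.comp (measurable_fderiv ℝ g)

variable [FiniteDimensional ℝ V]

/-- Almost every slope lies in at most one Laguerre cell, since the Legendre transform is
differentiable there. -/
lemma ae_mem_cell_imp_eq_gradient (hZ1 : ∀ z ∈ Z, ‖z‖ ≤ 1)
    (hZ : ∀ p, ∃ z ∈ Z, p ∈ cell Z H z) :
    ∀ᵐ p, ∀ z ∈ Z, p ∈ cell Z H z → ∇ (legendre Z H) p = z := by
  have h1 : ∀ p, ∃ z, ‖z‖ ≤ 1 ∧ IsSubgradient (legendre Z H) p z := fun p => by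
    obtain ⟨z, hz, hp⟩ := hZ p
    exact ⟨z, hZ1 z hz, isSubgradient_legendre hZ hz hp⟩
  filter_upwards [ae_differentiableAt_of_isSubgradient h1] with p hp z hz hpz
  exact gradient_eq_of_isSubgradient hp (isSubgradient_legendre hZ hz hpz)

end Duality

/-! ### The Monge–Ampère measure of a Legendre transform -/

section DualMongeAmpere

variable {n : ℕ} {g : EuclideanSpace ℝ (Fin n) → ℝ} {C : ℝ}

lemma le_legendre_univ (hC : ∀ p, ‖p‖ - C ≤ g p) {x : EuclideanSpace ℝ (Fin n)}
    (hx : ‖x‖ ≤ 1) (p : EuclideanSpace ℝ (Fin n)) :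
    ⟪p, x⟫ - g p ≤ legendre univ g x := by
  refine le_csSup ⟨C, ?_⟩ ⟨p, mem_univ _, by rw [real_inner_comm]⟩
  rintro _ ⟨p, -, rfl⟩
  have h1 := real_inner_le_norm x p
  have h2 := mul_le_mul_of_nonneg_right hx (norm_nonneg p)
  have h3 := hC p
  simp only
  linarith

lemma legendre_univ_le {x : EuclideanSpace ℝ (Fin n)} {c : ℝ} (h : ∀ p, ⟪p, x⟫ - g p ≤ c) :
    legendre univ g x ≤ c := by
  refine csSup_le (univ_nonempty.image _) ?_
  rintro _ ⟨p, -, rfl⟩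
  simpa only [real_inner_comm] using h p

lemma legendre_univ_eq (hC : ∀ p, ‖p‖ - C ≤ g p) {x p : EuclideanSpace ℝ (Fin n)}
    (hx : ‖x‖ ≤ 1) (hp : IsSubgradient g p x) : legendre univ g x = ⟪p, x⟫ - g p := by
  refine le_antisymm (legendre_univ_le fun p' => ?_) (le_legendre_univ hC hx p)
  have := hp p'
  rw [inner_sub_right, real_inner_comm p' x, real_inner_comm p x] at this
  linarith

lemma convexOn_legendre_univ (hC : ∀ p, ‖p‖ - C ≤ g p) :
    ConvexOn ℝ (closedBall 0 1) (legendre univ g) := by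
  refine ⟨convex_closedBall _ _, fun x hx y hy a b ha hb hab => legendre_univ_le fun p => ?_⟩
  rw [mem_closedBall_zero_iff] at hx hy
  have h1 := mul_le_mul_of_nonneg_left (le_legendre_univ hC hx p) ha
  have h2 := mul_le_mul_of_nonneg_left (le_legendre_univ hC hy p) hb
  rw [inner_add_right, real_inner_smul_right, real_inner_smul_right, smul_eq_mul, smul_eq_mul]
  have h3 : g p = a * g p + b * g p := by rw [← add_mul, hab, one_mul]
  linarith

/-- Slopes of supporting planes of the Legendre transform of `g` at points of the open ball
correspond to subgradients of `g`. -/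
lemma mem_subdifferential_legendre_iff (hC : ∀ p, ‖p‖ - C ≤ g p)
    (hg : ∀ p, ∃ z, ‖z‖ ≤ 1 ∧ IsSubgradient g p z) {x p : EuclideanSpace ℝ (Fin n)}
    (hx : x ∈ ball 0 1) :
    p ∈ subdifferential (ball 0 1) (legendre univ g) x ↔ IsSubgradient g p x := by
  have hx1 : ‖x‖ ≤ 1 := (mem_ball_zero_iff.1 hx).le
  constructor
  · intro hp
    obtain ⟨y, hy, hyp⟩ := hg p
    have hvy := legendre_univ_eq hC hy hyp
    have hconv := convexOn_legendre_univ hC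
    have key : ∀ l ∈ Ioo (0 : ℝ) 1, legendre univ g x - ⟪p, x⟫ ≤
        l * (-g p) + (1 - l) * legendre univ g 0 := by
      intro l hl
      have h1 := hp (l • y) (by
        rw [mem_ball_zero_iff, norm_smul, Real.norm_of_nonneg hl.1.le]
        nlinarith [hl.1, hl.2, norm_nonneg y])
      have h2 := hconv.2 (mem_closedBall_zero_iff.2 hy)
        (mem_closedBall_self (zero_le_one (α := ℝ))) hl.1.le
        (sub_nonneg.2 hl.2.le) (by ring)
      rw [smul_zero, add_zero, hvy, smul_eq_mul, smul_eq_mul] at h2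
      rw [inner_sub_right, real_inner_smul_right] at h1
      linarith
    have hlim : legendre univ g x - ⟪p, x⟫ ≤ -g p := by
      have ht : Tendsto (fun l : ℝ => l * (-g p) + (1 - l) * legendre univ g 0) (𝓝[<] 1)
          (𝓝 (1 * (-g p) + (1 - 1) * legendre univ g 0)) := by
        apply Tendsto.mono_left _ nhdsWithin_le_nhds
        exact Continuous.tendsto (by fun_prop) 1
      rw [one_mul, sub_self, zero_mul, add_zero] at ht
      exact ge_of_tendsto ht
        (eventually_of_mem (Ioo_mem_nhdsLT one_pos) key)
    intro p'
    have := le_legendre_univ hC hx1 p'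
    rw [inner_sub_right, real_inner_comm p' x, real_inner_comm p x]
    linarith
  · intro hp y hy
    have hy1 : ‖y‖ ≤ 1 := (mem_ball_zero_iff.1 hy).le
    rw [legendre_univ_eq hC hx1 hp, inner_sub_right]
    linarith [le_legendre_univ hC hy1 p]

/-- The Monge–Ampère measure of the Legendre transform of `g` is the push-forward of Lebesgue
measure under the gradient of `g`. -/
lemma mongeAmpereMeasure_legendre (hC : ∀ p, ‖p‖ - C ≤ g p)
    (hg : ∀ p, ∃ z, ‖z‖ ≤ 1 ∧ IsSubgradient g p z) {A : Set (EuclideanSpace ℝ (Fin n))}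
    (hA : A ⊆ ball 0 1) :
    mongeAmpereMeasure (ball 0 1) (legendre univ g) A = volume (∇ g ⁻¹' A) := by
  refine measure_congr ?_
  filter_upwards [ae_differentiableAt_of_isSubgradient hg] with p hp
  refine propext ⟨fun h => ?_, fun h => ?_⟩
  · obtain ⟨x, hx, hpx⟩ := mem_iUnion₂.1 h
    change ∇ g p ∈ A
    rwa [gradient_eq_of_isSubgradient hp
      ((mem_subdifferential_legendre_iff hC hg (hA hx)).1 hpx)]
  · refine mem_iUnion₂.2 ⟨∇ g p, h, ?_⟩
    rw [mem_subdifferential_legendre_iff hC hg (hA h)]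
    obtain ⟨z, -, hz⟩ := hg p
    exact isSubgradient_gradient hp ⟨z, hz⟩

end DualMongeAmpere

/-! ### Nodes and heights -/

section Nodes

variable {V : Type*} [NormedAddCommGroup V] {Y : Finset V} {z : V}

/-- The points at which the discrete problem prescribes data: the unit sphere, which carries the
boundary values, and finitely many interior points, which carry the Dirac masses. -/
def nodes (Y : Finset V) : Set V := sphere 0 1 ∪ ↑Y

lemma norm_le_one_of_mem_nodes (hY : (Y : Set V) ⊆ ball 0 1) (hz : z ∈ nodes Y) : ‖z‖ ≤ 1 := by
  rcases hz with hz | hz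
  · exact (mem_sphere_zero_iff_norm.1 hz).le
  · exact (mem_ball_zero_iff.1 (hY hz)).le

/-- Interior nodes keep a positive distance from all other nodes, including the sphere. -/
lemma exists_separation (hY : (Y : Set V) ⊆ ball 0 1) :
    ∃ δ > 0, ∀ y ∈ Y, ∀ z ∈ nodes Y, z ≠ y → δ ≤ ‖z - y‖ := by
  have key : ∀ᶠ δ in 𝓝[>] (0 : ℝ), ∀ y ∈ Y, δ < 1 - ‖y‖ ∧ ∀ z ∈ Y, z ≠ y → δ < ‖z - y‖ := by
    refine (Filter.eventually_all_finset Y).2 fun y hy => Eventually.filter_mono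
      nhdsWithin_le_nhds (Eventually.and ?_ ((Filter.eventually_all_finset Y).2 fun z hz => ?_))
    · exact eventually_lt_nhds (sub_pos.2 (mem_ball_zero_iff.1 (hY hy)))
    · by_cases hzy : z = y
      · exact Eventually.of_forall fun _ h => absurd hzy h
      · filter_upwards [eventually_lt_nhds (norm_pos_iff.2 (sub_ne_zero.2 hzy))] with δ hδ _
        exact hδ
  obtain ⟨δ, h, hδ⟩ := (key.and self_mem_nhdsWithin).exists
  refine ⟨δ, hδ, fun y hy z hz hzy => ?_⟩
  rcases hz with hz | hz
  · have h1 := norm_sub_norm_le z y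
    rw [mem_sphere_zero_iff_norm.1 hz] at h1
    linarith [(h y hy).1]
  · exact ((h y hy).2 z hz hzy).le

open Classical in
/-- The heights `h` on the interior nodes, extended by the boundary values `φ`. -/
noncomputable def nodeHeight (Y : Finset V) (φ : V → ℝ) (h : Y → ℝ) (z : V) : ℝ :=
  if hz : z ∈ Y then h ⟨z, hz⟩ else φ z

lemma nodeHeight_coe {V : Type*} {Y : Finset V} (φ : V → ℝ) (h : Y → ℝ) (y : Y) :
    nodeHeight Y φ h y = h y := by
  simp [nodeHeight]

lemma nodeHeight_of_mem_sphere (hY : (Y : Set V) ⊆ ball 0 1) (φ : V → ℝ) (h : Y → ℝ)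
    (hz : z ∈ sphere 0 1) : nodeHeight Y φ h z = φ z := by
  have : z ∉ Y := fun h => by
    have h1 := mem_ball_zero_iff.1 (hY h)
    rw [mem_sphere_zero_iff_norm.1 hz] at h1
    exact lt_irrefl _ h1
  simp [nodeHeight, this]

end Nodes

/-! ### The discrete Dirichlet problem -/

section Discrete

variable {V : Type*} [NormedAddCommGroup V] [InnerProductSpace ℝ V]

/-- The Laguerre cell of `z` with its defining inequalities relaxed by `ε` (tightened if
`ε < 0`). -/
def slackCell (Z : Set V) (H : V → ℝ) (z : V) (ε : ℝ) : Set V :=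
  {p | ∀ z' ∈ Z, z' ≠ z → ⟪p, z'⟫ - H z' ≤ ⟪p, z⟫ - H z + ε}

lemma slackCell_zero (Z : Set V) (H : V → ℝ) (z : V) : slackCell Z H z 0 = cell Z H z := by
  ext p
  refine ⟨fun h z' hz' => ?_, fun h z' hz' _ => by simpa using h z' hz'⟩
  rcases eq_or_ne z' z with rfl | hne
  · exact le_rfl
  · simpa using h z' hz' hne

lemma slackCell_mono (Z : Set V) (H : V → ℝ) (z : V) : Monotone (slackCell Z H z) :=
  fun _ _ h _ hp z' hz' hne => (hp z' hz' hne).trans (by linarith)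

lemma cell_subset_slackCell {Z : Set V} {H H' : V → ℝ} {y : V} {ε : ℝ}
    (h : ∀ z ∈ Z, |H z - H' z| ≤ ε / 2) (hy : y ∈ Z) :
    cell Z H' y ⊆ slackCell Z H y ε := by
  intro p hp z hz _
  have h1 := abs_le.1 (h z hz)
  have h2 := abs_le.1 (h y hy)
  have h3 := hp z hz
  linarith

lemma isClosed_slackCell (Z : Set V) (H : V → ℝ) (z : V) (ε : ℝ) :
    IsClosed (slackCell Z H z ε) := by
  have : slackCell Z H z ε =
      ⋂ z' ∈ Z, ⋂ _ : z' ≠ z, {p | ⟪p, z'⟫ - H z' ≤ ⟪p, z⟫ - H z + ε} := by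
    ext p; simp [slackCell]
  rw [this]
  exact isClosed_biInter fun z' _ => isClosed_iInter fun _ =>
    isClosed_le (by fun_prop) (by fun_prop)

lemma exists_sphere_inner_eq_norm [Nontrivial V] (p : V) :
    ∃ z ∈ sphere (0 : V) 1, ⟪p, z⟫ = ‖p‖ := by
  rcases eq_or_ne p 0 with rfl | hp
  · obtain ⟨z, hz⟩ := NormedSpace.sphere_nonempty (E := V) (x := 0) (r := 1) |>.2 zero_le_one
    exact ⟨z, hz, by simp⟩
  · refine ⟨‖p‖⁻¹ • p, ?_, ?_⟩
    · rw [mem_sphere_zero_iff_norm, norm_smul, norm_inv, norm_norm,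
        inv_mul_cancel₀ (norm_ne_zero_iff.2 hp)]
    · rw [real_inner_smul_right, real_inner_self_eq_norm_sq, pow_two, ← mul_assoc,
        inv_mul_cancel₀ (norm_ne_zero_iff.2 hp), one_mul]

variable {Y : Finset V} {φ H : V → ℝ} {B C ε : ℝ} {p y z : V}

/-- If the boundary values are at most `C`, then slopes in the cell of an interior point `y` are
bounded in terms of the height at `y` and the distance to the sphere. -/
lemma norm_mul_le_of_mem_slackCell [Nontrivial V] (hC : ∀ z ∈ sphere (0 : V) 1, H z ≤ C)
    (hy : ‖y‖ < 1) (hp : p ∈ slackCell (nodes Y) H y ε) :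
    (1 - ‖y‖) * ‖p‖ ≤ C - H y + ε := by
  obtain ⟨z, hz, hpz⟩ := exists_sphere_inner_eq_norm p
  have h1 := hp z (Or.inl hz) (by
    rintro rfl
    exact hy.ne (mem_sphere_zero_iff_norm.1 hz))
  have h2 := real_inner_le_norm p y
  have h3 := hC z hz
  nlinarith

lemma norm_mul_le_of_mem_cell [Nontrivial V] (hC : ∀ z ∈ sphere (0 : V) 1, H z ≤ C)
    (hy : ‖y‖ < 1) (hp : p ∈ cell (nodes Y) H y) : (1 - ‖y‖) * ‖p‖ ≤ C - H y := by
  rw [← slackCell_zero] at hp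
  simpa using norm_mul_le_of_mem_slackCell hC hy hp

/-- The cells of the nodes cover the space of slopes: the supremum defining the Legendre transform
is attained on the compact set of nodes. -/
lemma exists_mem_cell [Nontrivial V] [FiniteDimensional ℝ V] (hH : ContinuousOn H (sphere 0 1))
    (p : V) : ∃ z ∈ nodes Y, p ∈ cell (nodes Y) H z := by
  have hne : (sphere (0 : V) 1).Nonempty := NormedSpace.sphere_nonempty.2 zero_le_one
  obtain ⟨z, hz, hmax⟩ := (isCompact_sphere (0 : V) 1).exists_isMaxOn hne
    (f := fun z => ⟪p, z⟫ - H z) (by fun_prop)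
  rcases Y.eq_empty_or_nonempty with rfl | hYne
  · refine ⟨z, Or.inl hz, fun z' hz' => ?_⟩
    rcases hz' with hz' | hz'
    · exact hmax hz'
    · simp at hz'
  · obtain ⟨y, hy, hymax⟩ := Y.exists_max_image (fun z => ⟪p, z⟫ - H z) hYne
    rcases le_total (⟪p, z⟫ - H z) (⟪p, y⟫ - H y) with h | h
    · refine ⟨y, Or.inr hy, fun z' hz' => ?_⟩
      rcases hz' with hz' | hz'
      · exact le_trans (hmax hz') h
      · exact hymax z' hz'
    · refine ⟨z, Or.inl hz, fun z' hz' => ?_⟩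
      rcases hz' with hz' | hz'
      · exact hmax hz'
      · exact le_trans (hymax z' hz') h

variable [Nontrivial V] [FiniteDimensional ℝ V] [MeasurableSpace V] [BorelSpace V]

lemma exists_radius_lt_volume_ball {c : ENNReal} (hc : c ≠ ⊤) :
    ∃ R > 0, ∀ r ≥ R, ∀ x : V, c < volume (ball x r) := by
  have : NoncompactSpace V := NormedSpace.noncompactSpace ℝ V
  have h1 : Tendsto (fun k : ℕ => volume (ball (0 : V) k)) atTop (𝓝 ⊤) := by
    have := tendsto_measure_iUnion_atTop (μ := (volume : Measure V))
      (s := fun k : ℕ => ball (0 : V) k) (fun a b h => ball_subset_ball (by exact_mod_cast h))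
    rwa [iUnion_ball_nat, measure_univ_of_isAddLeftInvariant] at this
  obtain ⟨k, hk, hk0⟩ := ((h1.eventually (lt_mem_nhds (lt_top_iff_ne_top.2 hc))).and
    (eventually_gt_atTop 0)).exists
  refine ⟨k, by exact_mod_cast hk0, fun r hr x => hk.trans_le ?_⟩
  rw [Measure.addHaar_ball_center volume x]
  exact measure_mono (ball_subset_ball hr)

/-- Relaxing the inequalities of a cell by a small amount changes its volume little, because the
cell is the intersection of the relaxed cells and these are bounded. -/
lemma tendsto_volume_slackCell (hC : ∀ z ∈ sphere (0 : V) 1, H z ≤ C) (hy : ‖y‖ < 1) :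
    Tendsto (fun j : ℕ => volume (slackCell (nodes Y) H y (1 / ((j : ℝ) + 1)))) atTop
      (𝓝 (volume (cell (nodes Y) H y))) := by
  have hcell : cell (nodes Y) H y = ⋂ j : ℕ, slackCell (nodes Y) H y (1 / ((j : ℝ) + 1)) := by
    rw [← slackCell_zero]
    refine subset_antisymm (subset_iInter fun j => slackCell_mono _ _ _ (by positivity)) ?_
    intro p hp z' hz' hne
    refine ge_of_tendsto (tendsto_const_nhds.add tendsto_one_div_add_atTop_nhds_zero_nat)
      (Eventually.of_forall fun j => mem_iInter.1 hp j z' hz' hne)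
  rw [hcell]
  refine tendsto_measure_iInter_atTop
    (fun j => (isClosed_slackCell _ _ _ _).measurableSet.nullMeasurableSet)
    (fun i j hij => slackCell_mono _ _ _ (one_div_le_one_div_of_le (by positivity) (by gcongr)))
    ⟨0, ?_⟩
  refine ((measure_mono fun p hp => ?_).trans_lt
    (measure_closedBall_lt_top (x := (0 : V)) (r := (C - H y + 1) / (1 - ‖y‖)))).ne
  rw [mem_closedBall_zero_iff, le_div_iff₀ (sub_pos.2 hy), mul_comm]
  simpa using norm_mul_le_of_mem_slackCell hC hy hp

/-- Tightening the inequalities of a cell by a small amount changes its volume little, because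
the set of slopes lying in two cells is null. -/
lemma tendsto_volume_slackCell_neg (hY : (Y : Set V) ⊆ ball 0 1)
    (hH : ContinuousOn H (sphere 0 1)) (hy : y ∈ Y) :
    Tendsto (fun j : ℕ => volume (slackCell (nodes Y) H y (-(1 / ((j : ℝ) + 1))))) atTop
      (𝓝 (volume (cell (nodes Y) H y))) := by
  have hmono : Monotone fun j : ℕ => slackCell (nodes Y) H y (-(1 / ((j : ℝ) + 1))) :=
    fun i j hij => slackCell_mono _ _ _
      (neg_le_neg (one_div_le_one_div_of_le (by positivity) (by gcongr)))
  have hcell : volume (cell (nodes Y) H y) =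
      volume (⋃ j : ℕ, slackCell (nodes Y) H y (-(1 / ((j : ℝ) + 1)))) := by
    classical
    refine measure_congr ?_
    filter_upwards [ae_mem_cell_imp_eq_gradient (fun z hz => norm_le_one_of_mem_nodes hY hz)
      (exists_mem_cell (Y := Y) hH)] with p hp
    refine propext ⟨fun hpy => ?_, fun h => ?_⟩
    · -- the maximum over the other nodes is attained, hence strictly smaller
      obtain ⟨z, hz, hpz⟩ := exists_mem_cell (Y := Y.erase y) hH p
      have hsub : nodes (Y.erase y) ⊆ nodes Y := union_subset_union_right _ (by simp)
      have hzy : z ≠ y := by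
        rintro rfl
        rcases hz with hz | hz
        · have h1 := mem_ball_zero_iff.1 (hY hy)
          rw [mem_sphere_zero_iff_norm.1 hz] at h1
          exact lt_irrefl _ h1
        · simp at hz
      have hlt : ⟪p, z⟫ - H z < ⟪p, y⟫ - H y := by
        refine lt_of_le_of_ne (hpy z (hsub hz)) fun heq => hzy ?_
        rw [← hp z (hsub hz) fun z' hz' => (hpy z' hz').trans heq.ge, hp y (Or.inr hy) hpy]
      obtain ⟨j, hj⟩ := exists_nat_one_div_lt (sub_pos.2 hlt)
      refine mem_iUnion.2 ⟨j, fun z' hz' hne => ?_⟩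
      have := hpz z' (by
        rcases hz' with hz' | hz'
        · exact Or.inl hz'
        · exact Or.inr (by simpa [hne] using hz'))
      linarith
    · obtain ⟨j, hj⟩ := mem_iUnion.1 h
      have : p ∈ slackCell (nodes Y) H y 0 :=
        slackCell_mono _ _ _ (neg_nonpos.2 (by positivity)) hj
      rwa [slackCell_zero] at this
  rw [hcell]
  exact tendsto_measure_iUnion_atTop hmono

/-- The heights of a steep paraboloid have cells of volume at least `c`. -/
lemma exists_height_le_volume_cell (hY : (Y : Set V) ⊆ ball 0 1)
    (hφ0 : ∀ z ∈ sphere (0 : V) 1, 0 ≤ φ z) {c : ENNReal} (hc : c ≠ ⊤) :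
    ∃ h : Y → ℝ, (∀ y, h y ≤ 0) ∧ ∀ y : Y, c ≤ volume (cell (nodes Y) (nodeHeight Y φ h) y) := by
  obtain ⟨δ, hδ, hsep⟩ := exists_separation hY
  obtain ⟨R, hR, hvol⟩ := exists_radius_lt_volume_ball (V := V) hc
  set M := R / δ with hM
  have hM0 : 0 < M := by positivity
  refine ⟨fun y => M * (‖(y : V)‖ ^ 2 - 1), fun y => ?_, fun y => ?_⟩
  · have h1 := mem_ball_zero_iff.1 (hY y.2)
    have h2 : ‖(y : V)‖ ^ 2 ≤ 1 := pow_le_one₀ (norm_nonneg _) h1.le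
    nlinarith
  · refine (hvol R le_rfl ((2 * M) • (y : V))).le.trans (measure_mono fun p hp => ?_)
    rw [← slackCell_zero]
    intro z hz hzy
    have hlow : M * (‖z‖ ^ 2 - 1) ≤
        nodeHeight Y φ (fun y => M * (‖(y : V)‖ ^ 2 - 1)) z := by
      rcases hz with hz | hz
      · rw [nodeHeight_of_mem_sphere hY _ _ hz, mem_sphere_zero_iff_norm.1 hz]
        simpa using hφ0 z hz
      · exact (nodeHeight_coe φ (fun y : Y => M * (‖(y : V)‖ ^ 2 - 1)) ⟨z, hz⟩).ge
    rw [nodeHeight_coe]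
    have hδz := hsep y y.2 z hz hzy
    have h1 : ⟪p - (2 * M) • (y : V), z - y⟫ ≤ R * ‖z - y‖ :=
      (real_inner_le_norm _ _).trans
        (mul_le_mul_of_nonneg_right (mem_ball_iff_norm.1 hp).le (norm_nonneg _))
    have h2 : R * ‖z - y‖ ≤ M * ‖z - y‖ ^ 2 := by
      have : R = M * δ := by rw [hM]; field_simp
      rw [this, pow_two, mul_assoc]
      gcongr
    have h3 := norm_sub_sq_real z (y : V)
    rw [inner_sub_left, real_inner_smul_left, inner_sub_right, inner_sub_right,
      real_inner_self_eq_norm_sq] at h1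
    rw [real_inner_comm] at h3
    rw [h3] at h2
    nlinarith

/-- Existence for the discrete problem: there are heights whose cells have the prescribed volumes,
where the prescribed volume at a node may depend on the height there. The heights are those of a
maximal subsolution. -/
theorem exists_volume_cell_eq {m : V → ℝ → ℝ} (hY : (Y : Set V) ⊆ ball 0 1)
    (hφ : ContinuousOn φ (sphere 0 1)) (hφ0 : ∀ z ∈ sphere (0 : V) 1, 0 ≤ φ z)
    (hφC : ∀ z ∈ sphere (0 : V) 1, φ z ≤ C) (hm : ∀ y ∈ Y, Continuous (m y))
    (hB : ∀ y ∈ Y, ∀ h ≤ C, m y h ≤ B) :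
    ∃ H : V → ℝ, (∀ z ∈ sphere (0 : V) 1, H z = φ z) ∧
      ∀ y ∈ Y, volume (cell (nodes Y) H y) = ENNReal.ofReal (m y (H y)) := by
  classical
  have hC0 : 0 ≤ C := by
    obtain ⟨z, hz⟩ := NormedSpace.sphere_nonempty (E := V) (x := 0) (r := 1) |>.2 zero_le_one
    exact (hφ0 z hz).trans (hφC z hz)
  have hcont : ∀ h : Y → ℝ, ContinuousOn (nodeHeight Y φ h) (sphere 0 1) := fun h =>
    hφ.congr fun z hz => nodeHeight_of_mem_sphere hY φ h hz
  have hle : ∀ h : Y → ℝ, ∀ z ∈ sphere (0 : V) 1, nodeHeight Y φ h z ≤ C := fun h z hz => by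
    rw [nodeHeight_of_mem_sphere hY φ h hz]
    exact hφC z hz
  have hlt1 : ∀ y : Y, ‖(y : V)‖ < 1 := fun y => mem_ball_zero_iff.1 (hY y.2)
  obtain ⟨h₀, h₀0, h₀vol⟩ := exists_height_le_volume_cell hY hφ0
    (ENNReal.ofReal_ne_top (r := B))
  let T : Set (Y → ℝ) := ⋂ y : Y,
    {h | ENNReal.ofReal (m y (h y)) ≤ volume (cell (nodes Y) (nodeHeight Y φ h) y)}
  have hT : IsClosed T := by
    refine isClosed_iInter fun y => isOpen_compl_iff.1 (isOpen_iff_mem_nhds.2 fun h hh => ?_)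
    rw [mem_compl_iff, mem_ofPred_eq, not_le] at hh
    obtain ⟨c, hc1, hc2⟩ := exists_between hh
    obtain ⟨j, hj⟩ := ((tendsto_volume_slackCell (Y := Y) (hle h) (hlt1 y)).eventually
      (gt_mem_nhds hc1)).exists
    have hmc : Continuous fun h' : Y → ℝ => ENNReal.ofReal (m y (h' y)) :=
      ENNReal.continuous_ofReal.comp ((hm y y.2).comp (continuous_apply y))
    filter_upwards [hmc.continuousAt.eventually (lt_mem_nhds hc2),
      ball_mem_nhds h (show (0 : ℝ) < 1 / ((j : ℝ) + 1) / 2 by positivity)] with h' h1 h2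
    rw [mem_compl_iff, mem_ofPred_eq, not_le]
    have hsub : cell (nodes Y) (nodeHeight Y φ h') y ⊆
        slackCell (nodes Y) (nodeHeight Y φ h) y (1 / ((j : ℝ) + 1)) := by
      refine cell_subset_slackCell (fun z hz => ?_) (Or.inr y.2)
      rcases hz with hz | hz
      · rw [nodeHeight_of_mem_sphere hY φ _ hz, nodeHeight_of_mem_sphere hY φ _ hz, sub_self,
          abs_zero]
        positivity
      · have e1 := nodeHeight_coe φ h ⟨z, hz⟩
        have e2 := nodeHeight_coe φ h' ⟨z, hz⟩
        simp only at e1 e2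
        rw [e1, e2, ← Real.dist_eq, dist_comm]
        exact (dist_le_pi_dist h' h _).trans (mem_ball.1 h2).le
    exact ((measure_mono hsub).trans hj.le).trans_lt h1
  have hS : IsCompact (T ∩ Icc h₀ fun _ => C) := (isCompact_Icc).inter_left hT
  have hSne : (T ∩ Icc h₀ fun _ => C).Nonempty := by
    refine ⟨h₀, mem_iInter.2 fun y => ?_, le_rfl, fun y => (h₀0 y).trans hC0⟩
    exact (ENNReal.ofReal_le_ofReal (hB y y.2 _ ((h₀0 y).trans hC0))).trans (h₀vol y)
  obtain ⟨h, ⟨hhT, hh0, hhC⟩, hmax⟩ := hS.exists_isMaxOn hSne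
    (f := fun h : Y → ℝ => ∑ y, h y) (by fun_prop)
  refine ⟨nodeHeight Y φ h, fun z hz => nodeHeight_of_mem_sphere hY φ h hz, ?_⟩
  suffices hmain : ∀ y : Y, volume (cell (nodes Y) (nodeHeight Y φ h) y) =
      ENNReal.ofReal (m y (nodeHeight Y φ h y)) from fun y hy => hmain ⟨y, hy⟩
  intro y
  rw [nodeHeight_coe]
  refine le_antisymm (not_lt.1 fun hlt => ?_) (mem_iInter.1 hhT y)
  -- a node with too large a cell can be raised
  have hmt : Tendsto (fun j : ℕ => ENNReal.ofReal (m y (h y + 1 / ((j : ℝ) + 1)))) atTop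
      (𝓝 (ENNReal.ofReal (m y (h y)))) := by
    have h1 : Tendsto (fun j : ℕ => h y + 1 / ((j : ℝ) + 1)) atTop (𝓝 (h y + 0)) :=
      tendsto_const_nhds.add tendsto_one_div_add_atTop_nhds_zero_nat
    rw [add_zero] at h1
    exact (ENNReal.continuous_ofReal.comp (hm y y.2)).continuousAt.tendsto.comp h1
  obtain ⟨j, hj⟩ := (hmt.eventually_lt (tendsto_volume_slackCell_neg hY (hcont h) y.2) hlt).exists
  set ε : ℝ := 1 / ((j : ℝ) + 1) with hε
  have hε0 : 0 < ε := by positivity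
  set h' : Y → ℝ := Function.update h y (h y + ε) with hh'
  have hhh' : h ≤ h' := by
    intro i
    rcases eq_or_ne i y with rfl | hi
    · simp [hh', hε0.le]
    · simp [hh', hi]
  have hHH' : ∀ z, nodeHeight Y φ h z ≤ nodeHeight Y φ h' z := by
    intro z
    unfold nodeHeight
    split_ifs
    · exact hhh' _
    · exact le_rfl
  have hsub : slackCell (nodes Y) (nodeHeight Y φ h) y (-ε) ⊆
      cell (nodes Y) (nodeHeight Y φ h') y := by
    intro p hp
    rw [← slackCell_zero]
    intro z hz hne
    have h1 := hp z hz hne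
    have h2 := hHH' z
    rw [nodeHeight_coe] at h1 ⊢
    have h3 : h' y = h y + ε := by simp [hh']
    rw [h3]
    linarith
  have hh'T : h' ∈ T := by
    refine mem_iInter.2 fun i => ?_
    rcases eq_or_ne i y with rfl | hi
    · have h3 : h' i = h i + ε := by simp [hh']
      rw [mem_ofPred_eq, h3]
      exact hj.le.trans (measure_mono hsub)
    · have h3 : h' i = h i := by simp [hh', hi]
      rw [mem_ofPred_eq, h3]
      refine (mem_iInter.1 hhT i).trans (measure_mono fun p hp z hz => ?_)
      have h1 := hp z hz
      have h2 := hHH' z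
      rw [nodeHeight_coe] at h1 ⊢
      rw [h3]
      linarith
  have hh'C : h' ≤ fun _ => C := by
    intro i
    rcases eq_or_ne i y with rfl | hi
    · obtain ⟨p, hp⟩ := nonempty_of_measure_ne_zero (hj.trans_le' bot_le).ne'
      have h1 := norm_mul_le_of_mem_cell (hle h') (hlt1 i) (hsub hp)
      rw [nodeHeight_coe] at h1
      have h2 := mul_nonneg (sub_nonneg.2 (hlt1 i).le) (norm_nonneg p)
      linarith
    · have h3 : h' i = h i := by simp [hh', hi]
      rw [h3]
      exact hhC i
  have hsum : ∑ i, h i < ∑ i, h' i :=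
    Finset.sum_lt_sum (fun i _ => hhh' i) ⟨y, Finset.mem_univ _, by simp [hh', hε0]⟩
  exact absurd (hmax ⟨hh'T, hh0.trans hhh', hh'C⟩) (not_le.2 hsum)

end Discrete

/-! ### Boundary barrier -/

section Estimates

variable {V : Type*} [NormedAddCommGroup V] [InnerProductSpace ℝ V]
variable {Y : Finset V} {H : V → ℝ} {p₀ y : V}

/-- For `y` at distance `d` from the sphere, `{p | ‖p‖ - ⟪p, y⟫ < m}` is a long thin set
in the direction of `y`, which contains a ball of radius of order `m / √d`. -/
lemma norm_sub_inner_lt {m : ℝ} (hm : 0 < m) (hy1 : ‖y‖ < 1) (hy : 1 - ‖y‖ ≤ 1 / 4) {p : V}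
    (hp : p ∈ ball ((m / (3 * (1 - ‖y‖))) • (‖y‖⁻¹ • y)) (m / (3 * √(1 - ‖y‖)))) :
    ‖p‖ - ⟪p, y⟫ < m := by
  set d := 1 - ‖y‖ with hd
  have hd0 : 0 < d := sub_pos.2 hy1
  have hyn : ‖y‖ ≠ 0 := by intro h; rw [h] at hd; linarith
  set e := ‖y‖⁻¹ • y with he
  have hen : ‖e‖ = 1 := by rw [he, norm_smul, norm_inv, norm_norm, inv_mul_cancel₀ hyn]
  have hye : y = (1 - d) • e := by
    rw [hd, sub_sub_cancel, he, smul_smul, mul_inv_cancel₀ hyn, one_smul]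
  set a := m / (3 * d) with ha
  set ρ := m / (3 * √d) with hρ
  have hsd : 0 < √d := Real.sqrt_pos.2 hd0
  have hsq : √d * √d = d := Real.mul_self_sqrt hd0.le
  have ha0 : 0 < a := by positivity
  have had : a * d = m / 3 := by rw [ha]; field_simp
  have hρ0 : 0 < ρ := by positivity
  have hρa : ρ ^ 2 = a * (m / 3) := by
    rw [hρ, ha, div_pow, mul_pow, pow_two (√d), hsq]
    field_simp
  have hρle : ρ ≤ a / 2 := by
    have h1 : m / 3 ≤ a / 4 := by nlinarith
    nlinarith
  obtain ⟨z, rfl⟩ : ∃ z, p = a • e + z := ⟨p - a • e, by abel⟩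
  have hz : ‖z‖ < ρ := by simpa using hp
  have hin : ⟪a • e + z, e⟫ = a + ⟪z, e⟫ := by
    rw [inner_add_left, real_inner_smul_left, real_inner_self_eq_norm_sq, hen]; ring
  have hze := abs_le.1 ((abs_real_inner_le_norm z e).trans (by rw [hen, mul_one]))
  have hnsq : ‖a • e + z‖ ^ 2 = a ^ 2 + 2 * a * ⟪z, e⟫ + ‖z‖ ^ 2 := by
    rw [norm_add_sq_real, norm_smul, hen, real_inner_smul_left, real_inner_comm z e,
      Real.norm_of_nonneg ha0.le]
    ring
  have hyin : ⟪a • e + z, y⟫ = (1 - d) * (a + ⟪z, e⟫) := by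
    rw [hye, real_inner_smul_right, hin]
  rw [hyin]
  set t := ⟪z, e⟫
  set N := ‖a • e + z‖ with hN
  have hN0 : 0 ≤ N := norm_nonneg _
  -- `N² - (a + t)² = ‖z‖² - t² ≤ ρ²`, and `N + (a + t) ≥ a`
  have hNle : N ≤ a + t + m / 3 := by
    have h1 : 0 ≤ a + t := by linarith
    by_contra hcon
    rw [not_le] at hcon
    have h2 : (a + t + m / 3) ^ 2 < N ^ 2 := pow_lt_pow_left₀ hcon (by linarith) two_ne_zero
    have h3 : ‖z‖ ^ 2 ≤ ρ ^ 2 := pow_le_pow_left₀ (norm_nonneg z) hz.le 2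
    have h4 : 0 ≤ (a + 2 * t) * (m / 3) := mul_nonneg (by linarith) (by linarith)
    nlinarith [sq_nonneg t]
  have h5 : d * (a + t) ≤ m / 2 := by nlinarith
  nlinarith

variable [Nontrivial V] [FiniteDimensional ℝ V] [MeasurableSpace V] [BorelSpace V]

/-- If the height at `y` is more than `m` below an affine function that is below the boundary
values, then the cells of the interior nodes cover a translate of `{p | ‖p‖ - ⟪p, y⟫ < m}`. -/
lemma le_height_of_lt_volume_ball {W : ENNReal} {a m ρ : ℝ} {c : V}
    (hH : ContinuousOn H (sphere 0 1)) (hW : ∑ y ∈ Y, volume (cell (nodes Y) H y) ≤ W)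
    (hy : y ∈ Y) (hℓ : ∀ z ∈ sphere (0 : V) 1, a + ⟪p₀, z⟫ ≤ H z)
    (hball : ∀ p ∈ ball c ρ, ‖p‖ - ⟪p, y⟫ < m) (hvol : W < volume (ball (p₀ + c) ρ)) :
    a + ⟪p₀, y⟫ - m ≤ H y := by
  by_contra hlt
  rw [not_le] at hlt
  refine absurd ((measure_mono fun p hp => ?_).trans
    ((measure_biUnion_finset_le Y fun y => cell (nodes Y) H y).trans hW)) (not_le.2 hvol)
  obtain ⟨z, hz, hpz⟩ := exists_mem_cell (Y := Y) hH p
  have h1 := hpz y (Or.inr hy)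
  have h2 := hball (p - p₀) (by rwa [mem_ball_iff_norm, sub_sub, ← mem_ball_iff_norm])
  rw [inner_sub_left] at h2
  rcases hz with hz | hz
  · have h3 := hℓ z hz
    have h4 := real_inner_le_norm (p - p₀) z
    rw [mem_sphere_zero_iff_norm.1 hz, mul_one, inner_sub_left] at h4
    linarith
  · exact mem_iUnion₂.2 ⟨z, hz, hpz⟩

/-- Boundary barrier: if the cells of the interior nodes have total volume at most `W`, then the
heights lie above every affine function below the boundary values, up to an error `m` and a multiple
`L` of the distance to the sphere, where `L` depends only on `m` and `W`. -/
lemma exists_barrier {W : ENNReal} (hW : W ≠ ⊤) {m : ℝ} (hm : 0 < m) :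
    ∃ L : ℝ, 0 ≤ L ∧ ∀ (Y : Finset V) (H : V → ℝ), (Y : Set V) ⊆ ball 0 1 →
      ContinuousOn H (sphere 0 1) → ∑ y ∈ Y, volume (cell (nodes Y) H y) ≤ W →
      ∀ (a : ℝ) (p₀ : V), (∀ z ∈ sphere (0 : V) 1, a + ⟪p₀, z⟫ ≤ H z) →
      ∀ y ∈ Y, a + ⟪p₀, y⟫ - m - L * (1 - ‖y‖) ≤ H y := by
  obtain ⟨R, hR, hvol⟩ := exists_radius_lt_volume_ball (V := V) hW
  set d₀ := min (1 / 4) ((m / (3 * R)) ^ 2) with hd₀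
  have hd₀0 : 0 < d₀ := by positivity
  refine ⟨2 * R / d₀, by positivity, fun Y H hY hH hWY a p₀ hℓ y hy => ?_⟩
  have hy1 : ‖y‖ < 1 := mem_ball_zero_iff.1 (hY hy)
  rcases le_total (1 - ‖y‖) d₀ with hd | hd
  · have h1 := le_height_of_lt_volume_ball hH hWY hy hℓ
      (fun p hp => norm_sub_inner_lt hm hy1 (hd.trans (min_le_left _ _)) hp) (hvol _ ?_ _)
    · have : 0 ≤ 2 * R / d₀ * (1 - ‖y‖) := mul_nonneg (by positivity) (sub_pos.2 hy1).le
      linarith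
    · have h2 : √(1 - ‖y‖) ≤ m / (3 * R) :=
        Real.sqrt_le_iff.2 ⟨by positivity, hd.trans (min_le_right _ _)⟩
      have h3 : 0 < √(1 - ‖y‖) := Real.sqrt_pos.2 (sub_pos.2 hy1)
      rw [le_div_iff₀ (by positivity)] at h2
      rw [ge_iff_le, le_div_iff₀ (by positivity)]
      linarith
  · have h1 := le_height_of_lt_volume_ball (m := 2 * R) (c := 0) (ρ := R) hH hWY hy hℓ
      (fun p hp => ?_) (hvol _ le_rfl _)
    · have : 2 * R ≤ 2 * R / d₀ * (1 - ‖y‖) := by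
        rw [div_mul_eq_mul_div, le_div_iff₀ hd₀0]
        gcongr
      linarith
    · have h2 := abs_le.1 (abs_real_inner_le_norm p y)
      have h3 := mem_ball_zero_iff.1 hp
      nlinarith [norm_nonneg p]

end Estimates

/-! ### Limits of convex functions with bounded slopes -/

section Compactness

lemma tendsto_apply_of_lipschitzWith {V : Type*} [SeminormedAddCommGroup V] {ι : Type*}
    {l : Filter ι} {G : ι → V → ℝ} {g : V → ℝ} (hL : ∀ i, LipschitzWith 1 (G i))
    (hG : ∀ q, Tendsto (fun i => G i q) l (𝓝 (g q))) {p : ι → V} {p' : V}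
    (hp : Tendsto p l (𝓝 p')) : Tendsto (fun i => G i (p i)) l (𝓝 (g p')) := by
  have h0 : Tendsto (fun i => dist (p i) p') l (𝓝 0) := by
    simpa using hp.dist (tendsto_const_nhds (x := p'))
  have h1 : Tendsto (fun i => G i (p i) - G i p') l (𝓝 0) := by
    refine squeeze_zero_norm (fun i => ?_) h0
    simpa [Real.dist_eq] using (hL i).dist_le_mul (p i) p'
  simpa using h1.add (hG p')

variable {V : Type*} [NormedAddCommGroup V] [InnerProductSpace ℝ V]
variable {ι : Type*} {l : Filter ι} {G : ι → V → ℝ} {g : V → ℝ}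

lemma IsSubgradient.of_tendsto [l.NeBot] {p z : ι → V} {p' z' : V}
    (h : ∀ᶠ i in l, IsSubgradient (G i) (p i) (z i))
    (hG : ∀ q, Tendsto (fun i => G i q) l (𝓝 (g q)))
    (hGp : Tendsto (fun i => G i (p i)) l (𝓝 (g p'))) (hp : Tendsto p l (𝓝 p'))
    (hz : Tendsto z l (𝓝 z')) : IsSubgradient g p' z' := fun q =>
  le_of_tendsto_of_tendsto (hGp.add (hz.inner (tendsto_const_nhds.sub hp))) (hG q)
    (h.mono fun _ hi => hi q)

variable [FiniteDimensional ℝ V]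

lemma exists_tendsto_of_norm_le (U : Ultrafilter ι) {z : ι → V} {R : ℝ}
    (hz : ∀ᶠ i in (U : Filter ι), ‖z i‖ ≤ R) :
    ∃ z', ‖z'‖ ≤ R ∧ Tendsto z U (𝓝 z') := by
  obtain ⟨z', hz', hlim⟩ := (isCompact_closedBall (0 : V) R).ultrafilter_le_nhds (U.map z)
    (le_principal_iff.2 (hz.mono fun i hi => mem_closedBall_zero_iff.2 hi))
  exact ⟨z', mem_closedBall_zero_iff.1 hz', hlim⟩

lemma exists_isSubgradient_of_tendsto [l.NeBot]
    (hsub : ∀ i p, ∃ z, ‖z‖ ≤ 1 ∧ IsSubgradient (G i) p z)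
    (hG : ∀ q, Tendsto (fun i => G i q) l (𝓝 (g q))) (p : V) :
    ∃ z, ‖z‖ ≤ 1 ∧ IsSubgradient g p z := by
  choose z hz1 hz using fun i => hsub i p
  obtain ⟨z', hz', hlim⟩ := exists_tendsto_of_norm_le (Ultrafilter.of l)
    (Eventually.of_forall hz1)
  have hle : ((Ultrafilter.of l : Ultrafilter ι) : Filter ι) ≤ l := Ultrafilter.of_le l
  exact ⟨z', hz', IsSubgradient.of_tendsto (l := Ultrafilter.of l)
    (Eventually.of_forall hz) (fun q => (hG q).mono_left hle) ((hG p).mono_left hle)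
    tendsto_const_nhds hlim⟩

/-- A locally bounded sequence of `1`-Lipschitz functions has a pointwise convergent
subsequence. -/
lemma exists_subseq_tendsto {G : ℕ → V → ℝ} {M : ℝ} (hL : ∀ i, LipschitzWith 1 (G i))
    (hM : ∀ i p, |G i p| ≤ ‖p‖ + M) :
    ∃ (τ : ℕ → ℕ) (g : V → ℝ), StrictMono τ ∧
      ∀ p, Tendsto (fun i => G (τ i) p) atTop (𝓝 (g p)) := by
  let d : ℕ → V := TopologicalSpace.denseSeq V
  have hd : DenseRange d := TopologicalSpace.denseRange_denseSeq V
  have hcomp : IsCompact (Set.pi univ fun j => Icc (-(‖d j‖ + M)) (‖d j‖ + M)) :=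
    isCompact_univ_pi fun _ => isCompact_Icc
  obtain ⟨b, -, τ, hτ, hb⟩ := hcomp.tendsto_subseq (x := fun i j => G i (d j))
    fun i j _ => abs_le.1 (hM i (d j))
  rw [tendsto_pi_nhds] at hb
  have hcauchy : ∀ p, CauchySeq fun i => G (τ i) p := by
    intro p
    rw [Metric.cauchySeq_iff']
    intro ε hε
    obtain ⟨j, hj⟩ := hd.exists_dist_lt p (show 0 < ε / 3 by positivity)
    obtain ⟨N, hN⟩ := Metric.cauchySeq_iff'.1 (hb j).cauchySeq (ε / 3) (by positivity)
    refine ⟨N, fun i hi => ?_⟩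
    have h1 := (hL (τ i)).dist_le_mul p (d j)
    have h2 := (hL (τ N)).dist_le_mul (d j) p
    rw [dist_comm (d j) p] at h2
    have h3 := hN i hi
    simp only [Function.comp_apply, NNReal.coe_one, one_mul] at h1 h2 h3
    have h4 := dist_triangle4 (G (τ i) p) (G (τ i) (d j)) (G (τ N) (d j)) (G (τ N) p)
    linarith
  choose g hg using fun p => cauchySeq_tendsto_of_complete (hcauchy p)
  exact ⟨τ, g, hτ, hg⟩

/-- Gradients converge where all functions are differentiable, since limits of subgradients are
subgradients of the limit. -/
lemma tendsto_gradient (hsub : ∀ i p, ∃ z, ‖z‖ ≤ 1 ∧ IsSubgradient (G i) p z)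
    (hG : ∀ q, Tendsto (fun i => G i q) l (𝓝 (g q))) [CompleteSpace V] {p : V}
    (hd : ∀ i, DifferentiableAt ℝ (G i) p) (hdg : DifferentiableAt ℝ g p) :
    Tendsto (fun i => ∇ (G i) p) l (𝓝 (∇ g p)) := by
  rw [tendsto_iff_ultrafilter]
  intro U hU
  have hsg : ∀ i, ‖∇ (G i) p‖ ≤ 1 ∧ IsSubgradient (G i) p (∇ (G i) p) := fun i => by
    obtain ⟨z, hz, hzp⟩ := hsub i p
    rw [gradient_eq_of_isSubgradient (hd i) hzp]
    exact ⟨hz, hzp⟩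
  obtain ⟨z', -, hlim⟩ := exists_tendsto_of_norm_le U
    (Eventually.of_forall fun i => (hsg i).1)
  have := IsSubgradient.of_tendsto (l := (U : Filter ι)) (Eventually.of_forall fun i => (hsg i).2)
    (fun q => (hG q).mono_left hU) ((hG p).mono_left hU) tendsto_const_nhds hlim
  rw [gradient_eq_of_isSubgradient hdg this]
  exact hlim

end Compactness

/-- Values of Legendre transforms converge along with the points and bounded slopes at which they
are attained. -/
lemma tendsto_legendre_univ {n : ℕ} {ι : Type*} {l : Filter ι}
    {G : ι → EuclideanSpace ℝ (Fin n) → ℝ} {g : EuclideanSpace ℝ (Fin n) → ℝ} {C R : ℝ}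
    (hL : ∀ i, LipschitzWith 1 (G i)) (hG : ∀ q, Tendsto (fun i => G i q) l (𝓝 (g q)))
    (hC : ∀ p, ‖p‖ - C ≤ g p) {p y : ι → EuclideanSpace ℝ (Fin n)}
    {x : EuclideanSpace ℝ (Fin n)} (hx : ‖x‖ ≤ 1) (hy : Tendsto y l (𝓝 x))
    (hR : ∀ᶠ i in l, ‖p i‖ ≤ R) (hp : ∀ᶠ i in l, IsSubgradient (G i) (p i) (y i)) :
    Tendsto (fun i => ⟪p i, y i⟫ - G i (p i)) l (𝓝 (legendre univ g x)) := by
  rw [tendsto_iff_ultrafilter]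
  intro U hU
  obtain ⟨p', -, hlim⟩ := exists_tendsto_of_norm_le U (hU hR)
  have hGU : ∀ q, Tendsto (fun i => G i q) U (𝓝 (g q)) := fun q => (hG q).mono_left hU
  have hGp := tendsto_apply_of_lipschitzWith hL hGU hlim
  have := IsSubgradient.of_tendsto (l := (U : Filter ι)) (hU hp) hGU hGp hlim (hy.mono_left hU)
  rw [legendre_univ_eq hC hx this]
  exact (hlim.inner (hy.mono_left hU)).sub hGp

/-! ### Integrals over Laguerre cells -/

section WeakLimit

lemma sum_range_mul_eq_integral {X V : Type*} [MeasurableSpace X] (T : SimpleFunc X V)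
    (μ : Measure X) [IsFiniteMeasure μ] (F : V → ℝ) :
    ∑ y ∈ T.range, μ.real (T ⁻¹' {y}) * F y = ∫ x, F (T x) ∂μ := by
  classical
  have h : ∀ x, F (T x) = ∑ y ∈ T.range, (T ⁻¹' {y}).indicator (fun _ => F y) x := by
    intro x
    rw [Finset.sum_eq_single_of_mem (T x) (T.mem_range_self x)]
    · simp
    · intro y _ hy
      simp [hy.symm]
  simp_rw [h]
  rw [integral_finsetSum _ fun y _ => (integrable_const _).indicator (T.measurableSet_fiber y)]
  refine Finset.sum_congr rfl fun y _ => ?_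
  rw [integral_indicator_const _ (T.measurableSet_fiber y), smul_eq_mul]

variable {V : Type*} [NormedAddCommGroup V] [InnerProductSpace ℝ V] [Nontrivial V]
  [FiniteDimensional ℝ V] [CompleteSpace V] [MeasurableSpace V] [BorelSpace V]

/-- The gradient of the Legendre transform of heights on nodes takes the value `y` on the cell
of `y`, and values on the sphere elsewhere. -/
lemma integral_comp_gradient_legendre {Y : Finset V} {H : V → ℝ} (hY : (Y : Set V) ⊆ ball 0 1)
    (hH : ContinuousOn H (sphere 0 1)) (hfin : ∀ y ∈ Y, volume (cell (nodes Y) H y) ≠ ⊤)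
    {ψ : V → ℝ} (hψ : ∀ z ∈ sphere (0 : V) 1, ψ z = 0) :
    ∫ p, ψ (∇ (legendre (nodes Y) H) p) =
      ∑ y ∈ Y, volume.real (cell (nodes Y) H y) * ψ y := by
  classical
  have hae : (fun p => ψ (∇ (legendre (nodes Y) H) p)) =ᵐ[volume]
      fun p => ∑ y ∈ Y, (cell (nodes Y) H y).indicator (fun _ => ψ y) p := by
    filter_upwards [ae_mem_cell_imp_eq_gradient (fun z hz => norm_le_one_of_mem_nodes hY hz)
      (exists_mem_cell (Y := Y) hH)] with p hp
    obtain ⟨z, hz, hpz⟩ := exists_mem_cell (Y := Y) hH p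
    have hother : ∀ y ∈ Y, y ≠ z → p ∉ cell (nodes Y) H y := fun y hy hne hpy =>
      hne (by rw [← hp y (Or.inr hy) hpy, hp z hz hpz])
    rw [hp z hz hpz]
    by_cases hzY : z ∈ Y
    · rw [Finset.sum_eq_single_of_mem z hzY]
      · simp [hpz]
      · intro y hy hne
        simp [hother y hy hne]
    · rw [Finset.sum_eq_zero]
      · exact hψ z (hz.resolve_right hzY)
      · intro y hy
        simp [hother y hy (by rintro rfl; exact hzY hy)]
  rw [integral_congr_ae hae, integral_finsetSum]
  · refine Finset.sum_congr rfl fun y _ => ?_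
    rw [integral_indicator_const _ (isClosed_cell _ _ _).measurableSet, smul_eq_mul]
  · intro y hy
    exact (integrableOn_const (hfin y hy)).integrable_indicator (isClosed_cell _ _ _).measurableSet

end WeakLimit

/-! ### Continuous approximation of open sets -/

section Bump

/-- Continuous functions supported well inside the open set `U`, increasing to its indicator. -/
noncomputable def bump {X : Type*} [PseudoMetricSpace X] (U : Set X) (k : ℕ) (x : X) : ℝ :=
  max 0 (min 1 (k * infDist x Uᶜ - 1))

section PseudoMetric

variable {X : Type*} [PseudoMetricSpace X]

lemma continuous_bump (U : Set X) (k : ℕ) : Continuous (bump U k) := by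
  unfold bump
  have := continuous_infDist_pt Uᶜ
  fun_prop

lemma bump_nonneg (U : Set X) (k : ℕ) (x : X) : 0 ≤ bump U k x := le_max_left _ _

lemma bump_le_one (U : Set X) (k : ℕ) (x : X) : bump U k x ≤ 1 :=
  max_le zero_le_one (min_le_left _ _)

lemma monotone_bump (U : Set X) (x : X) : Monotone fun k => bump U k x := by
  intro i j hij
  have h : (i : ℝ) * infDist x Uᶜ ≤ j * infDist x Uᶜ :=
    mul_le_mul_of_nonneg_right (by exact_mod_cast hij) infDist_nonneg
  exact max_le_max le_rfl (min_le_min le_rfl (sub_le_sub_right h 1))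

lemma bump_of_notMem {U : Set X} {x : X} (hx : x ∉ U) (k : ℕ) : bump U k x = 0 := by
  have : infDist x Uᶜ = 0 := infDist_zero_of_mem hx
  simp [bump, this]

lemma tendsto_bump {U : Set X} (hU : IsOpen U) (hUc : Uᶜ.Nonempty) (x : X) :
    Tendsto (fun k => bump U k x) atTop (𝓝 (U.indicator 1 x)) := by
  by_cases hx : x ∈ U
  · have hpos : 0 < infDist x Uᶜ :=
      (hU.isClosed_compl.notMem_iff_infDist_pos hUc).1 (by simpa using hx)
    rw [indicator_of_mem hx, Pi.one_apply]
    refine tendsto_const_nhds.congr' ?_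
    filter_upwards [tendsto_natCast_atTop_atTop.eventually_ge_atTop (2 / infDist x Uᶜ)] with k hk
    rw [div_le_iff₀ hpos] at hk
    rw [bump, min_eq_left (by linarith), max_eq_right zero_le_one]
  · simp_rw [indicator_of_notMem hx, bump_of_notMem hx]
    exact tendsto_const_nhds

end PseudoMetric

lemma bump_eq_zero_of_lt_norm {V : Type*} [NormedAddCommGroup V] [InnerProductSpace ℝ V]
    [Nontrivial V] {U : Set V} (hU : U ⊆ ball 0 1) {k : ℕ} {x : V}
    (hx : 1 - 1 / ((k : ℝ) + 1) < ‖x‖) : bump U k x = 0 := by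
  by_cases hxU : x ∈ U
  · have hx1 : ‖x‖ < 1 := mem_ball_zero_iff.1 (hU hxU)
    obtain ⟨z, hz, hxz⟩ := exists_sphere_inner_eq_norm x
    rw [mem_sphere_zero_iff_norm] at hz
    have hdist : infDist x Uᶜ ≤ 1 - ‖x‖ := by
      refine (infDist_le_dist_of_mem (y := z) fun h => ?_).trans_eq ?_
      · exact (mem_ball_zero_iff.1 (hU h)).ne hz
      · rw [dist_eq_norm, ← sq_eq_sq₀ (norm_nonneg _) (by linarith), norm_sub_sq_real, hxz, hz]
        ring
    have hk : (0 : ℝ) < k + 1 := by positivity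
    have h1 : ((k : ℝ) + 1) * (1 - ‖x‖) < 1 := by
      rw [sub_lt_comm, lt_div_iff₀ hk] at hx
      linarith
    have h2 : (k : ℝ) * infDist x Uᶜ ≤ k * (1 - ‖x‖) := by gcongr
    rw [bump, max_eq_left]
    exact (min_le_right _ _).trans (by linarith)
  · exact bump_of_notMem hxU k

end Bump

/-! ### Weak limits of Monge–Ampère measures -/

section WeakConvergence

variable {n : ℕ} [Nontrivial (EuclideanSpace ℝ (Fin n))]

/-- Passage to the limit: if Laguerre cells carry the volumes `f y (H y)` times the volumes of the
cells of a partition whose tagged points are the nodes, and the Legendre transforms of the heights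
converge to `g`, then the push-forward of Lebesgue measure under `∇ g` has density `f x (v x)` in
the unit ball, where `v` is the Legendre transform of `g`. -/
lemma integral_comp_gradient_eq_of_tendsto
    {T : ℕ → SimpleFunc (EuclideanSpace ℝ (Fin n)) (EuclideanSpace ℝ (Fin n))}
    {H : ℕ → EuclideanSpace ℝ (Fin n) → ℝ} {f : EuclideanSpace ℝ (Fin n) → ℝ → ℝ}
    {g : EuclideanSpace ℝ (Fin n) → ℝ} {e ε : ℕ → ℝ} {B C M : ℝ}
    (hT : ∀ i, ((T i).range : Set (EuclideanSpace ℝ (Fin n))) ⊆ ball 0 1)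
    (hTx : ∀ x ∈ ball (0 : EuclideanSpace ℝ (Fin n)) 1,
      Tendsto (fun i => T i x) atTop (𝓝 x))
    (hf : Continuous (Function.uncurry f)) (hf0 : ∀ x h, 0 ≤ f x h)
    (hfB : ∀ x ∈ ball (0 : EuclideanSpace ℝ (Fin n)) 1, ∀ h ≤ C, f x h ≤ B)
    (hH : ∀ i, ContinuousOn (H i) (sphere 0 1)) (hHC : ∀ i, ∀ z ∈ sphere 0 1, H i z ≤ C)
    (hHM : ∀ i, ∀ z ∈ nodes (T i).range, -M ≤ H i z)
    (hε : ∀ i, 0 < ε i) (hεe : ∀ i, ε i * (T i).range.card ≤ e i) (he : Tendsto e atTop (𝓝 0))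
    (hvol : ∀ i, ∀ y ∈ (T i).range, volume (cell (nodes (T i).range) (H i) y) =
      ENNReal.ofReal ((volume.restrict (ball 0 1)).real (T i ⁻¹' {y}) * f y (H i y) + ε i))
    (hg : ∀ p, Tendsto (fun i => legendre (nodes (T i).range) (H i) p) atTop (𝓝 (g p)))
    (hC : ∀ p, ‖p‖ - C ≤ g p)
    {ψ : EuclideanSpace ℝ (Fin n) → ℝ} (hψ : Continuous ψ) (hψ0 : ∀ x, 0 ≤ ψ x)
    (hψ1 : ∀ x, ψ x ≤ 1) {δ : ℝ} (hδ : 0 < δ) (hψδ : ∀ x, 1 - δ < ‖x‖ → ψ x = 0) :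
    Integrable (fun p => ψ (∇ g p)) ∧
      ∫ p, ψ (∇ g p) = ∫ x in ball 0 1, ψ x * f x (legendre univ g x) := by
  have hfinite : IsFiniteMeasure ((volume : Measure (EuclideanSpace ℝ (Fin n))).restrict
      (ball 0 1)) := isFiniteMeasure_restrict.2 measure_ball_lt_top.ne
  set G : ℕ → EuclideanSpace ℝ (Fin n) → ℝ := fun i => legendre (nodes (T i).range) (H i) with hG
  have hcell : ∀ i p, ∃ z ∈ nodes (T i).range, p ∈ cell (nodes (T i).range) (H i) z :=
    fun i p => exists_mem_cell (hH i) p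
  have hsub : ∀ i p, ∃ z, ‖z‖ ≤ 1 ∧ IsSubgradient (G i) p z := fun i p => by
    obtain ⟨z, hz, hp⟩ := hcell i p
    exact ⟨z, norm_le_one_of_mem_nodes (hT i) hz, isSubgradient_legendre (hcell i) hz hp⟩
  have hsubg := exists_isSubgradient_of_tendsto hsub hg
  have hGlow : ∀ i p, ‖p‖ - C ≤ G i p := fun i p => by
    obtain ⟨z, hz, hpz⟩ := exists_sphere_inner_eq_norm p
    obtain ⟨z', hz', hp⟩ := hcell i p
    have h1 := hp z (Or.inl hz)
    rw [← legendre_eq_of_mem_cell hz' hp, hpz] at h1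
    linarith [hHC i z hz]
  have hGzero : ∀ i, G i 0 ≤ M := fun i => by
    obtain ⟨z, hz, hp⟩ := hcell i 0
    have : G i 0 = ⟪0, z⟫ - H i z := legendre_eq_of_mem_cell hz hp
    rw [inner_zero_left] at this
    linarith [hHM i z hz]
  -- gradients well inside the ball occur only at bounded slopes
  have hbound : ∀ i p z, IsSubgradient (G i) p z → ‖z‖ ≤ 1 - δ → ‖p‖ ≤ (C + M) / δ := by
    intro i p z hz hzδ
    have h1 := hz 0
    have h2 := real_inner_le_norm z p
    have h3 := mul_le_mul_of_nonneg_right hzδ (norm_nonneg p)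
    rw [zero_sub, inner_neg_right] at h1
    rw [le_div_iff₀ hδ]
    nlinarith [hGlow i p, hGzero i]
  have hae : ∀ᵐ p, (∀ i, DifferentiableAt ℝ (G i) p) ∧ DifferentiableAt ℝ g p :=
    (ae_all_iff.2 fun i => ae_differentiableAt_of_isSubgradient (hsub i)).and
      (ae_differentiableAt_of_isSubgradient hsubg)
  have hlimψ : ∀ᵐ p, Tendsto (fun i => ψ (∇ (G i) p)) atTop (𝓝 (ψ (∇ g p))) := by
    filter_upwards [hae] with p hp
    exact (hψ.tendsto _).comp (tendsto_gradient hsub hg hp.1 hp.2)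
  have hdom : ∀ i, ∀ᵐ p, ‖ψ (∇ (G i) p)‖ ≤
      (closedBall (0 : EuclideanSpace ℝ (Fin n)) ((C + M) / δ)).indicator (fun _ => (1 : ℝ)) p := by
    intro i
    filter_upwards [hae] with p hp
    rw [Real.norm_of_nonneg (hψ0 _)]
    rcases lt_or_ge (1 - δ) ‖∇ (G i) p‖ with h | h
    · rw [hψδ _ h]
      exact indicator_nonneg (fun _ _ => zero_le_one) _
    · obtain ⟨z, -, hz⟩ := hsub i p
      rw [indicator_of_mem]
      · exact hψ1 _
      · exact mem_closedBall_zero_iff.2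
          (hbound i p _ (isSubgradient_gradient (hp.1 i) ⟨z, hz⟩) h)
  have hint1 : Integrable ((closedBall (0 : EuclideanSpace ℝ (Fin n)) ((C + M) / δ)).indicator
      fun _ => (1 : ℝ)) :=
    (integrableOn_const measure_closedBall_lt_top.ne).integrable_indicator
      isClosed_closedBall.measurableSet
  have hmeas : ∀ g : EuclideanSpace ℝ (Fin n) → ℝ,
      AEStronglyMeasurable (fun p => ψ (∇ g p)) :=
    fun g => (hψ.measurable.comp (measurable_gradient g)).aestronglyMeasurable
  refine ⟨hint1.mono' (hmeas g) ?_, ?_⟩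
  · filter_upwards [hlimψ, ae_all_iff.2 hdom] with p h1 h2
    exact le_of_tendsto h1.norm (Eventually.of_forall h2)
  have hlim1 := tendsto_integral_of_dominated_convergence _ (fun i => hmeas (G i)) hint1 hdom hlimψ
  -- the discrete integrals
  have hψs : ∀ z ∈ sphere (0 : EuclideanSpace ℝ (Fin n)) 1, ψ z = 0 := fun z hz =>
    hψδ z (by rw [mem_sphere_zero_iff_norm.1 hz]; linarith)
  have hdisc : ∀ i, ∫ p, ψ (∇ (G i) p) =
      (∫ x in ball 0 1, ψ (T i x) * f (T i x) (H i (T i x))) + ε i * ∑ y ∈ (T i).range, ψ y := by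
    intro i
    rw [hG, integral_comp_gradient_legendre (hT i) (hH i)
      (fun y hy => by rw [hvol i y hy]; exact ENNReal.ofReal_ne_top) hψs,
      ← sum_range_mul_eq_integral (T i) (volume.restrict (ball 0 1))
        (fun y => ψ y * f y (H i y)), Finset.mul_sum, ← Finset.sum_add_distrib]
    refine Finset.sum_congr rfl fun y hy => ?_
    rw [measureReal_def, hvol i y hy, ENNReal.toReal_ofReal
      (add_nonneg (mul_nonneg measureReal_nonneg (hf0 _ _)) (hε i).le)]
    ring
  have herr : Tendsto (fun i => ε i * ∑ y ∈ (T i).range, ψ y) atTop (𝓝 0) := by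
    refine squeeze_zero (fun i => mul_nonneg (hε i).le (Finset.sum_nonneg fun y _ => hψ0 y))
      (fun i => ?_) he
    refine (mul_le_mul_of_nonneg_left ?_ (hε i).le).trans (hεe i)
    exact (Finset.sum_le_card_nsmul _ _ 1 fun y _ => hψ1 y).trans_eq (by simp)
  have hTmem : ∀ i x, T i x ∈ ball (0 : EuclideanSpace ℝ (Fin n)) 1 := fun i x =>
    hT i ((T i).mem_range_self x)
  have hcellne : ∀ i, ∀ y ∈ (T i).range, ∃ p, p ∈ cell (nodes (T i).range) (H i) y := by
    intro i y hy
    refine nonempty_of_measure_ne_zero (μ := volume) ?_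
    rw [hvol i y hy]
    exact (ENNReal.ofReal_pos.2
      (add_pos_of_nonneg_of_pos (mul_nonneg measureReal_nonneg (hf0 _ _)) (hε i))).ne'
  have hHle : ∀ i x, H i (T i x) ≤ C := by
    intro i x
    obtain ⟨p, hp⟩ := hcellne i _ ((T i).mem_range_self x)
    have h1 := mem_ball_zero_iff.1 (hTmem i x)
    have h2 := norm_mul_le_of_mem_cell (hHC i) h1 hp
    have h3 := mul_nonneg (sub_nonneg.2 h1.le) (norm_nonneg p)
    linarith
  have hheight : ∀ x ∈ ball (0 : EuclideanSpace ℝ (Fin n)) 1,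
      Tendsto (fun i => H i (T i x)) atTop (𝓝 (legendre univ g x)) := by
    intro x hx
    have hx1 := mem_ball_zero_iff.1 hx
    choose p hp using fun i => hcellne i _ ((T i).mem_range_self x)
    have hmem : ∀ i, T i x ∈ nodes (T i).range := fun i => Or.inr ((T i).mem_range_self x)
    have h1 := tendsto_legendre_univ (R := (C + M) / ((1 - ‖x‖) / 2))
      (fun i => lipschitzWith_of_isSubgradient (hsub i)) hg hC hx1.le (hTx x hx) (p := p) ?_
      (Eventually.of_forall fun i => isSubgradient_legendre (hcell i) (hmem i) (hp i))
    · refine h1.congr fun i => ?_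
      have h2 : G i (p i) = ⟪p i, T i x⟫ - H i (T i x) :=
        legendre_eq_of_mem_cell (hmem i) (hp i)
      rw [h2, sub_sub_cancel]
    · filter_upwards [(hTx x hx).norm.eventually
        (gt_mem_nhds (show ‖x‖ < (1 + ‖x‖) / 2 by linarith))] with i hi
      have h2 := norm_mul_le_of_mem_cell (hHC i) (by linarith) (hp i)
      have h3 := hHM i _ (hmem i)
      have h4 : (1 - ‖x‖) / 2 ≤ 1 - ‖T i x‖ := by linarith
      have h5 := mul_le_mul_of_nonneg_right h4 (norm_nonneg (p i))
      rw [le_div_iff₀ (by linarith)]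
      linarith
  have hlim2 : Tendsto (fun i => ∫ x in ball 0 1, ψ (T i x) * f (T i x) (H i (T i x))) atTop
      (𝓝 (∫ x in ball 0 1, ψ x * f x (legendre univ g x))) := by
    refine tendsto_integral_of_dominated_convergence (fun _ => B) (fun i => ?_)
      (integrable_const B) (fun i => Eventually.of_forall fun x => ?_) ?_
    · exact ((T i).map fun y => ψ y * f y (H i y)).aestronglyMeasurable
    · rw [Real.norm_of_nonneg (mul_nonneg (hψ0 _) (hf0 _ _))]
      exact (mul_le_of_le_one_left (hf0 _ _) (hψ1 _)).trans (hfB _ (hTmem i x) _ (hHle i x))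
    · filter_upwards [ae_restrict_mem measurableSet_ball] with x hx
      exact ((hψ.tendsto x).comp (hTx x hx)).mul
        ((hf.tendsto (x, legendre univ g x)).comp ((hTx x hx).prodMk_nhds (hheight x hx)))
  refine tendsto_nhds_unique hlim1 ?_
  simp_rw [hdisc]
  simpa using hlim2.add herr

/-- The conclusion of the passage to the limit, for all Borel sets instead of test functions. -/
lemma volume_preimage_gradient_eq {g : EuclideanSpace ℝ (Fin n) → ℝ}
    {ρ : EuclideanSpace ℝ (Fin n) → ℝ} {B : ℝ} (hρ : ContinuousOn ρ (ball 0 1))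
    (hρ0 : ∀ x, 0 ≤ ρ x) (hρB : ∀ x ∈ ball (0 : EuclideanSpace ℝ (Fin n)) 1, ρ x ≤ B)
    (h : ∀ ψ : EuclideanSpace ℝ (Fin n) → ℝ, Continuous ψ → (∀ x, 0 ≤ ψ x) → (∀ x, ψ x ≤ 1) →
      ∀ δ > 0, (∀ x, 1 - δ < ‖x‖ → ψ x = 0) → Integrable (fun p => ψ (∇ g p)) ∧
        ∫ p, ψ (∇ g p) = ∫ x in ball 0 1, ψ x * ρ x)
    {A : Set (EuclideanSpace ℝ (Fin n))} (hA : MeasurableSet A) (hAB : A ⊆ ball 0 1) :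
    volume (∇ g ⁻¹' A) = ∫⁻ x in A, ENNReal.ofReal (ρ x) := by
  have hfinite : IsFiniteMeasure ((volume : Measure (EuclideanSpace ℝ (Fin n))).restrict
      (ball 0 1)) := isFiniteMeasure_restrict.2 measure_ball_lt_top.ne
  have hmg := measurable_gradient g
  have hρm : AEMeasurable ρ (volume.restrict (ball 0 1)) := hρ.aemeasurable measurableSet_ball
  have hopen : ∀ U : Set (EuclideanSpace ℝ (Fin n)), IsOpen U → U ⊆ ball 0 1 →
      volume (∇ g ⁻¹' U) = ∫⁻ x in U, ENNReal.ofReal (ρ x) := by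
    intro U hU hUB
    have hUc : Uᶜ.Nonempty := by
      obtain ⟨z, hz, -⟩ := exists_sphere_inner_eq_norm (0 : EuclideanSpace ℝ (Fin n))
      exact ⟨z, fun hzU => (mem_ball_zero_iff.1 (hUB hzU)).ne (mem_sphere_zero_iff_norm.1 hz)⟩
    have hindic : ∀ x, Tendsto (fun k => ENNReal.ofReal (bump U k x)) atTop
        (𝓝 (U.indicator 1 x)) := fun x => by
      have heq : (U.indicator 1 x : ENNReal) = ENNReal.ofReal (U.indicator 1 x) := by
        by_cases hx : x ∈ U
        · rw [indicator_of_mem hx, indicator_of_mem hx, Pi.one_apply, Pi.one_apply,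
            ENNReal.ofReal_one]
        · rw [indicator_of_notMem hx, indicator_of_notMem hx, ENNReal.ofReal_zero]
      rw [heq]
      exact (ENNReal.continuous_ofReal.tendsto _).comp (tendsto_bump hU hUc x)
    have hlhs : Tendsto (fun k => ∫⁻ p, ENNReal.ofReal (bump U k (∇ g p))) atTop
        (𝓝 (volume (∇ g ⁻¹' U))) := by
      rw [← lintegral_indicator_one (hmg hU.measurableSet)]
      refine lintegral_tendsto_of_tendsto_of_monotone (fun k => ?_) ?_ ?_
      · exact (((continuous_bump U k).measurable.comp hmg).ennreal_ofReal).aemeasurable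
      · exact Eventually.of_forall fun p i j hij =>
          ENNReal.ofReal_le_ofReal (monotone_bump U _ hij)
      · exact Eventually.of_forall fun p => hindic (∇ g p)
    have hrhs : Tendsto (fun k => ∫⁻ x in ball 0 1, ENNReal.ofReal (bump U k x * ρ x)) atTop
        (𝓝 (∫⁻ x in U, ENNReal.ofReal (ρ x))) := by
      have heq : ∫⁻ x in U, ENNReal.ofReal (ρ x) =
          ∫⁻ x in ball 0 1, U.indicator 1 x * ENNReal.ofReal (ρ x) := by
        rw [← inter_eq_self_of_subset_left hUB, ← Measure.restrict_restrict hU.measurableSet,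
          ← lintegral_indicator hU.measurableSet]
        refine lintegral_congr fun x => ?_
        rw [inter_eq_self_of_subset_left hUB]
        by_cases hx : x ∈ U <;> simp [hx]
      rw [heq]
      simp_rw [ENNReal.ofReal_mul (bump_nonneg U _ _)]
      refine lintegral_tendsto_of_tendsto_of_monotone (fun k => ?_) ?_ ?_
      · exact ((continuous_bump U k).measurable.ennreal_ofReal.aemeasurable).mul
          hρm.ennreal_ofReal
      · exact Eventually.of_forall fun p i j hij =>
          mul_le_mul_left (ENNReal.ofReal_le_ofReal (monotone_bump U _ hij)) _
      · exact Eventually.of_forall fun x =>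
          ENNReal.Tendsto.mul_const (hindic x) (Or.inr ENNReal.ofReal_ne_top)
    refine tendsto_nhds_unique (hlhs.congr fun k => ?_) hrhs
    obtain ⟨h1, h2⟩ := h (bump U k) (continuous_bump U k) (bump_nonneg U k) (bump_le_one U k)
      (1 / ((k : ℝ) + 1)) (by positivity) (fun x hx => bump_eq_zero_of_lt_norm hUB hx)
    rw [← ofReal_integral_eq_lintegral_ofReal h1
      (Eventually.of_forall fun p => bump_nonneg U k _), h2,
      ofReal_integral_eq_lintegral_ofReal ?_
      (Eventually.of_forall fun x => mul_nonneg (bump_nonneg U k x) (hρ0 x))]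
    refine (integrable_const B).mono'
      ((continuous_bump U k).measurable.aemeasurable.mul hρm).aestronglyMeasurable ?_
    filter_upwards [ae_restrict_mem measurableSet_ball] with x hx
    rw [Real.norm_of_nonneg (mul_nonneg (bump_nonneg U k x) (hρ0 x))]
    exact (mul_le_of_le_one_left (hρ0 _) (bump_le_one U k x)).trans (hρB x hx)
  have hfin : ∫⁻ x in ball (0 : EuclideanSpace ℝ (Fin n)) 1, ENNReal.ofReal (ρ x) ≠ ⊤ := by
    refine ((setLIntegral_mono' measurableSet_ball fun x hx =>
      ENNReal.ofReal_le_ofReal (hρB x hx)).trans_lt ?_).ne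
    rw [setLIntegral_const]
    exact ENNReal.mul_lt_top ENNReal.ofReal_lt_top measure_ball_lt_top
  set ν₁ := (volume.map (∇ g)).restrict (ball (0 : EuclideanSpace ℝ (Fin n)) 1) with hν₁
  set ν₂ := (volume.restrict (ball (0 : EuclideanSpace ℝ (Fin n)) 1)).withDensity
    fun x => ENNReal.ofReal (ρ x) with hν₂
  have h1 : ∀ s, MeasurableSet s → ν₁ s = volume (∇ g ⁻¹' (s ∩ ball 0 1)) := fun s hs => by
    rw [hν₁, Measure.restrict_apply hs, Measure.map_apply hmg (hs.inter measurableSet_ball)]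
  have h2 : ∀ s, MeasurableSet s → ν₂ s = ∫⁻ x in s ∩ ball 0 1, ENNReal.ofReal (ρ x) :=
    fun s hs => by
      rw [hν₂, withDensity_apply _ hs, Measure.restrict_restrict hs]
  have hU : ∀ U : Set (EuclideanSpace ℝ (Fin n)), IsOpen U → ν₁ U = ν₂ U := fun U hU => by
    rw [h1 U hU.measurableSet, h2 U hU.measurableSet]
    exact hopen _ (hU.inter isOpen_ball) inter_subset_right
  have : IsFiniteMeasure ν₁ := ⟨by
    rw [hU univ isOpen_univ, h2 univ MeasurableSet.univ, univ_inter]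
    exact hfin.lt_top⟩
  have heq : ν₁ = ν₂ := ext_of_generate_finite {s | IsOpen s} BorelSpace.measurable_eq
    isPiSystem_isOpen (fun U h => hU U h) (hU univ isOpen_univ)
  have := h1 A hA
  rw [heq, h2 A hA, inter_eq_self_of_subset_left hAB] at this
  exact this.symm

end WeakConvergence

/-! ### The Dirichlet problem for bounded right-hand sides -/

section Dirichlet

variable {n : ℕ}

/-- A convex function is continuous in the open ball; at the sphere the continuous function `φ`
bounds it from above and agrees with it. -/
lemma continuousOn_closedBall_of_convexOn {v φ : EuclideanSpace ℝ (Fin n) → ℝ}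
    (hv : ConvexOn ℝ (closedBall 0 1) v) (hlsc : LowerSemicontinuousOn v (closedBall 0 1))
    (hφ : ContinuousOn φ (closedBall 0 1)) (hle : ∀ x ∈ closedBall 0 1, v x ≤ φ x)
    (hge : ∀ x ∈ sphere 0 1, φ x ≤ v x) : ContinuousOn v (closedBall 0 1) := by
  intro x hx
  rcases (mem_closedBall.1 hx).lt_or_eq with h | h
  · have hcont := (hv.subset ball_subset_closedBall (convex_ball _ _)).continuousOn isOpen_ball
    exact (hcont.continuousAt (isOpen_ball.mem_nhds h)).continuousWithinAt
  · refine tendsto_order.2 ⟨fun a ha => hlsc x hx a ha, fun a ha => ?_⟩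
    have h1 : φ x < a := (hge x h).trans_lt ha
    filter_upwards [(hφ x hx).eventually (gt_mem_nhds h1), self_mem_nhdsWithin] with y hy hyb
    exact (hle y hyb).trans_lt hy

variable [Nontrivial (EuclideanSpace ℝ (Fin n))]

/-- Solvability of the Dirichlet problem `det D²v = f(x, v)` in the unit ball, in the sense of
Aleksandrov. Boundary values `φ` are attained because they have supporting affine functions at
every boundary point. The hypothesis `hφup` says that affine functions below `φ` on the sphere are
below `φ` in the ball, which makes `φ` an upper barrier. -/
theorem exists_mongeAmpereMeasure_eq {φ : EuclideanSpace ℝ (Fin n) → ℝ}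
    {f : EuclideanSpace ℝ (Fin n) → ℝ → ℝ} {B C : ℝ}
    (hφ : ContinuousOn φ (closedBall 0 1)) (hφ0 : ∀ z ∈ sphere 0 1, 0 ≤ φ z)
    (hφC : ∀ z ∈ closedBall 0 1, φ z ≤ C)
    (hφsub : ∀ y ∈ sphere 0 1, ∃ p₀, ∀ z ∈ sphere 0 1, φ y + ⟪p₀, z - y⟫ ≤ φ z)
    (hφup : ∀ x ∈ closedBall 0 1, ∀ p, ∃ z ∈ sphere 0 1, ⟪p, x⟫ - φ x ≤ ⟪p, z⟫ - φ z)
    (hf : Continuous (Function.uncurry f)) (hf0 : ∀ x h, 0 ≤ f x h)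
    (hfB : ∀ x ∈ ball (0 : EuclideanSpace ℝ (Fin n)) 1, ∀ h ≤ C, f x h ≤ B) :
    ∃ v : EuclideanSpace ℝ (Fin n) → ℝ, ConvexOn ℝ (closedBall 0 1) v ∧
      ContinuousOn v (closedBall 0 1) ∧ (∀ x ∈ closedBall 0 1, v x ≤ φ x) ∧
      (∀ x ∈ sphere 0 1, φ x ≤ v x) ∧
      ∀ A : Set (EuclideanSpace ℝ (Fin n)), MeasurableSet A → A ⊆ ball 0 1 →
        mongeAmpereMeasure (ball 0 1) v A = ∫⁻ x in A, ENNReal.ofReal (f x (v x)) := by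
  have h0 : (0 : EuclideanSpace ℝ (Fin n)) ∈ ball (0 : EuclideanSpace ℝ (Fin n)) 1 :=
    mem_ball_self one_pos
  have hfinite : IsFiniteMeasure ((volume : Measure (EuclideanSpace ℝ (Fin n))).restrict
      (ball 0 1)) := isFiniteMeasure_restrict.2 measure_ball_lt_top.ne
  set μ := (volume : Measure (EuclideanSpace ℝ (Fin n))).restrict (ball 0 1) with hμ
  have hB0 : 0 ≤ B := (hf0 0 C).trans (hfB 0 h0 C le_rfl)
  have hφs : ContinuousOn φ (sphere 0 1) := hφ.mono sphere_subset_closedBall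
  have hφCs : ∀ z ∈ sphere 0 1, φ z ≤ C := fun z hz => hφC z (sphere_subset_closedBall hz)
  -- discretization; the extra mass `ε i` at each node keeps its cell nonempty
  let T : ℕ → SimpleFunc (EuclideanSpace ℝ (Fin n)) (EuclideanSpace ℝ (Fin n)) := fun i =>
    SimpleFunc.approxOn id measurable_id (ball 0 1) 0 h0 i
  have hT : ∀ i, ((T i).range : Set (EuclideanSpace ℝ (Fin n))) ⊆ ball 0 1 := by
    intro i y hy
    obtain ⟨x, rfl⟩ := SimpleFunc.mem_range.1 hy
    exact SimpleFunc.approxOn_mem measurable_id h0 i x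
  have hTx : ∀ x ∈ ball (0 : EuclideanSpace ℝ (Fin n)) 1,
      Tendsto (fun i => T i x) atTop (𝓝 x) := fun x hx =>
    SimpleFunc.tendsto_approxOn measurable_id h0 (subset_closure hx)
  let ε : ℕ → ℝ := fun i => 1 / (((i : ℝ) + 1) * ((T i).range.card + 1))
  have hε : ∀ i, 0 < ε i := fun i => by positivity
  have hεe : ∀ i, ε i * (T i).range.card ≤ 1 / ((i : ℝ) + 1) := fun i => by
    rw [div_mul_eq_mul_div, div_le_div_iff₀ (by positivity) (by positivity)]
    nlinarith [(Nat.cast_nonneg i : (0 : ℝ) ≤ i)]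
  have hε1 : ∀ i, ε i ≤ 1 := fun i => by
    refine div_le_one_of_le₀ ?_ (by positivity)
    have : (0 : ℝ) ≤ (T i).range.card := Nat.cast_nonneg _
    nlinarith [(Nat.cast_nonneg i : (0 : ℝ) ≤ i)]
  have hex : ∀ i, ∃ H : EuclideanSpace ℝ (Fin n) → ℝ, (∀ z ∈ sphere 0 1, H z = φ z) ∧
      ∀ y ∈ (T i).range, volume (cell (nodes (T i).range) H y) =
        ENNReal.ofReal (μ.real (T i ⁻¹' {y}) * f y (H y) + ε i) := by
    intro i
    refine exists_volume_cell_eq (m := fun y h => μ.real (T i ⁻¹' {y}) * f y h + ε i)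
      (B := μ.real univ * B + 1) (hT i) hφs hφ0 hφCs (fun y _ => ?_) (fun y hy h hh => ?_)
    · have : Continuous fun h => f y h := hf.comp (continuous_const.prodMk continuous_id)
      fun_prop
    · exact add_le_add (mul_le_mul (measureReal_mono (subset_univ _)) (hfB y (hT i hy) h hh)
        (hf0 _ _) measureReal_nonneg) (hε1 i)
  choose H hHφ hHvol using hex
  have hH : ∀ i, ContinuousOn (H i) (sphere 0 1) := fun i => hφs.congr (hHφ i)
  have hHC : ∀ i, ∀ z ∈ sphere 0 1, H i z ≤ C := fun i z hz => (hHφ i z hz).trans_le (hφCs z hz)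
  have hHle : ∀ i, ∀ y ∈ (T i).range, H i y ≤ C := by
    intro i y hy
    have hne : volume (cell (nodes (T i).range) (H i) y) ≠ 0 := by
      rw [hHvol i y hy]
      exact (ENNReal.ofReal_pos.2
        (add_pos_of_nonneg_of_pos (mul_nonneg measureReal_nonneg (hf0 _ _)) (hε i))).ne'
    obtain ⟨p, hp⟩ := nonempty_of_measure_ne_zero hne
    have h1 := mem_ball_zero_iff.1 (hT i hy)
    have h2 := norm_mul_le_of_mem_cell (hHC i) h1 hp
    have h3 := mul_nonneg (sub_nonneg.2 h1.le) (norm_nonneg p)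
    linarith
  -- total mass
  have hW : ∀ i, ∑ y ∈ (T i).range, volume (cell (nodes (T i).range) (H i) y) ≤
      ENNReal.ofReal (μ.real univ * B + 1) := by
    intro i
    rw [Finset.sum_congr rfl (hHvol i), ← ENNReal.ofReal_sum_of_nonneg fun y _ =>
      add_nonneg (mul_nonneg measureReal_nonneg (hf0 _ _)) (hε i).le]
    refine ENNReal.ofReal_le_ofReal ?_
    rw [Finset.sum_add_distrib, Finset.sum_const, nsmul_eq_mul]
    refine add_le_add ?_ ?_
    · calc ∑ y ∈ (T i).range, μ.real (T i ⁻¹' {y}) * f y (H i y)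
          ≤ ∑ y ∈ (T i).range, μ.real (T i ⁻¹' {y}) * B := by
            refine Finset.sum_le_sum fun y hy => ?_
            exact mul_le_mul_of_nonneg_left (hfB y (hT i hy) _ (hHle i y hy)) measureReal_nonneg
        _ = μ.real univ * B := by
            rw [sum_range_mul_eq_integral (T i) μ fun _ => B]
            simp
    · rw [mul_comm]
      refine (hεe i).trans (div_le_one_of_le₀ ?_ (by positivity))
      linarith [(Nat.cast_nonneg i : (0 : ℝ) ≤ i)]
  have hbar := fun m (hm : 0 < m) => exists_barrier (V := EuclideanSpace ℝ (Fin n))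
    (ENNReal.ofReal_ne_top (r := μ.real univ * B + 1)) (m := m) hm
  obtain ⟨L₁, hL₁, hbar1⟩ := hbar 1 one_pos
  have hHM : ∀ i, ∀ z ∈ nodes (T i).range, -(1 + L₁) ≤ H i z := by
    intro i z hz
    rcases hz with hz | hz
    · rw [hHφ i z hz]
      linarith [hφ0 z hz]
    · have h1 := hbar1 _ _ (hT i) (hH i) (hW i) 0 0
        (fun z hz => by simpa [hHφ i z hz] using hφ0 z hz) z hz
      have h2 : L₁ * (1 - ‖z‖) ≤ L₁ * 1 :=
        mul_le_mul_of_nonneg_left (by linarith [norm_nonneg z]) hL₁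
      rw [inner_zero_left] at h1
      linarith
  -- the Legendre transforms and their limit
  set G : ℕ → EuclideanSpace ℝ (Fin n) → ℝ := fun i => legendre (nodes (T i).range) (H i) with hG
  have hcell : ∀ i p, ∃ z ∈ nodes (T i).range, p ∈ cell (nodes (T i).range) (H i) z :=
    fun i p => exists_mem_cell (hH i) p
  have hsub : ∀ i p, ∃ z, ‖z‖ ≤ 1 ∧ IsSubgradient (G i) p z := fun i p => by
    obtain ⟨z, hz, hp⟩ := hcell i p
    exact ⟨z, norm_le_one_of_mem_nodes (hT i) hz, isSubgradient_legendre (hcell i) hz hp⟩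
  have hGge : ∀ i p, ∀ z ∈ nodes (T i).range, ⟪p, z⟫ - H i z ≤ G i p := fun i p z hz => by
    obtain ⟨z', hz', hp⟩ := hcell i p
    exact (hp z hz).trans_eq (legendre_eq_of_mem_cell hz' hp).symm
  have hGle : ∀ i p c, (∀ z ∈ nodes (T i).range, ⟪p, z⟫ - H i z ≤ c) → G i p ≤ c :=
    fun i p c h => by
      obtain ⟨z', hz', hp⟩ := hcell i p
      exact (legendre_eq_of_mem_cell hz' hp).trans_le (h z' hz')
  have hGlow : ∀ i p, ‖p‖ - C ≤ G i p := fun i p => by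
    obtain ⟨z, hz, hpz⟩ := exists_sphere_inner_eq_norm p
    have h1 := hGge i p z (Or.inl hz)
    rw [hpz] at h1
    linarith [hHC i z hz]
  have hGabs : ∀ i p, |G i p| ≤ ‖p‖ + (|C| + (1 + L₁)) := fun i p => by
    refine abs_le.2 ⟨?_, hGle i p _ fun z hz => ?_⟩
    · linarith [hGlow i p, le_abs_self C, norm_nonneg p]
    · have h1 := real_inner_le_norm p z
      have h2 := mul_le_mul_of_nonneg_left (norm_le_one_of_mem_nodes (hT i) hz) (norm_nonneg p)
      linarith [hHM i z hz, abs_nonneg C]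
  obtain ⟨τ, g, hτ, hg⟩ :=
    exists_subseq_tendsto (fun i => lipschitzWith_of_isSubgradient (hsub i)) hGabs
  have hC : ∀ p, ‖p‖ - C ≤ g p := fun p =>
    ge_of_tendsto (hg p) (Eventually.of_forall fun i => hGlow (τ i) p)
  have hsubg := exists_isSubgradient_of_tendsto (fun i => hsub (τ i)) hg
  set v := legendre univ g with hv
  have hvφ : ∀ x ∈ closedBall 0 1, v x ≤ φ x := fun x hx => legendre_univ_le fun p => by
    obtain ⟨z, hz, hpz⟩ := hφup x hx p
    have : ⟪p, z⟫ - φ z ≤ g p := ge_of_tendsto (hg p) (Eventually.of_forall fun i => by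
      rw [← hHφ (τ i) z hz]
      exact hGge (τ i) p z (Or.inl hz))
    linarith
  have hφv : ∀ y ∈ sphere 0 1, φ y ≤ v y := by
    intro y hy
    obtain ⟨p₀, hp₀⟩ := hφsub y hy
    have hy1 := mem_sphere_zero_iff_norm.1 hy
    refine le_of_forall_pos_le_add fun m hm => ?_
    obtain ⟨L, hL, hbarm⟩ := hbar m hm
    have hGp : ∀ i, G i (p₀ + L • y) ≤ ⟪p₀ + L • y, y⟫ - φ y + m := by
      intro i
      refine hGle i _ _ fun z hz => ?_
      have hyz := real_inner_le_norm y z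
      rw [hy1, one_mul] at hyz
      rw [inner_add_left, inner_add_left, real_inner_smul_left, real_inner_smul_left,
        real_inner_self_eq_norm_sq, hy1]
      have hz1 := mul_le_mul_of_nonneg_left hyz hL
      have hz2 := mul_le_mul_of_nonneg_left (norm_le_one_of_mem_nodes (hT i) hz) hL
      rcases hz with hz | hz
      · have h1 := hp₀ z hz
        rw [inner_sub_right] at h1
        rw [hHφ i z hz]
        linarith
      · have h1 := hbarm _ _ (hT i) (hH i) (hW i) (φ y - ⟪p₀, y⟫) p₀ (fun z hz => by
          have h2 := hp₀ z hz
          rw [inner_sub_right] at h2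
          rw [hHφ i z hz]
          linarith) z hz
        linarith
    have hgp : g (p₀ + L • y) ≤ ⟪p₀ + L • y, y⟫ - φ y + m :=
      le_of_tendsto (hg _) (Eventually.of_forall fun i => hGp (τ i))
    have := le_legendre_univ hC hy1.le (p₀ + L • y)
    linarith
  have hconv : ConvexOn ℝ (closedBall 0 1) v := convexOn_legendre_univ hC
  have hlsc : LowerSemicontinuousOn v (closedBall 0 1) := by
    intro x hx a ha
    obtain ⟨_, ⟨p, -, rfl⟩, hp⟩ := exists_lt_of_lt_csSup (univ_nonempty.image _) ha
    have hcont : Continuous fun y : EuclideanSpace ℝ (Fin n) => ⟪y, p⟫ - g p := by fun_prop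
    filter_upwards [nhdsWithin_le_nhds (hcont.continuousAt.eventually (lt_mem_nhds hp)),
      self_mem_nhdsWithin] with y hy hyb
    refine hy.trans_le ?_
    rw [real_inner_comm]
    exact le_legendre_univ hC (mem_closedBall_zero_iff.1 hyb) p
  have hvcont := continuousOn_closedBall_of_convexOn hconv hlsc hφ hvφ hφv
  refine ⟨v, hconv, hvcont, hvφ, hφv, fun A hA hAB => ?_⟩
  rw [mongeAmpereMeasure_legendre hC hsubg hAB]
  refine volume_preimage_gradient_eq (B := B) ?_ (fun x => hf0 _ _)
    (fun x hx => hfB x hx _ ((hvφ x (ball_subset_closedBall hx)).trans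
      (hφC x (ball_subset_closedBall hx)))) ?_ hA hAB
  · exact hf.comp_continuousOn (continuousOn_id.prodMk (hvcont.mono ball_subset_closedBall))
  · intro ψ hψ hψ0 hψ1 δ hδ hψδ
    exact integral_comp_gradient_eq_of_tendsto (T := T ∘ τ) (H := H ∘ τ) (ε := ε ∘ τ)
      (e := fun i => 1 / ((τ i : ℝ) + 1)) (fun i => hT (τ i))
      (fun x hx => (hTx x hx).comp hτ.tendsto_atTop) hf hf0 hfB (fun i => hH (τ i))
      (fun i => hHC (τ i)) (fun i => hHM (τ i)) (fun i => hε (τ i)) (fun i => hεe (τ i))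
      (tendsto_one_div_add_atTop_nhds_zero_nat.comp hτ.tendsto_atTop)
      (fun i => hHvol (τ i)) hg hC hψ hψ0 hψ1 hδ hψδ

end Dirichlet

/-! ### Projections onto coordinate subspaces -/

section Projections

variable {n : ℕ}

/-- The orthogonal projection onto the first `k` coordinates. -/
noncomputable def headProj (n k : ℕ) : EuclideanSpace ℝ (Fin n) →L[ℝ] EuclideanSpace ℝ (Fin n) :=
  LinearMap.toContinuousLinearMap
    { toFun := fun x => WithLp.toLp 2 fun i : Fin n => if (i : ℕ) < k then x i else 0
      map_add' := fun x y => by ext i; by_cases h : (i : ℕ) < k <;> simp [h]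
      map_smul' := fun a x => by ext i; by_cases h : (i : ℕ) < k <;> simp [h] }

/-- The orthogonal projection onto all coordinates but the first `k`. -/
noncomputable def tailProj (n k : ℕ) : EuclideanSpace ℝ (Fin n) →L[ℝ] EuclideanSpace ℝ (Fin n) :=
  LinearMap.toContinuousLinearMap
    { toFun := fun x => WithLp.toLp 2 fun i : Fin n => if (i : ℕ) < k then 0 else x i
      map_add' := fun x y => by ext i; by_cases h : (i : ℕ) < k <;> simp [h]
      map_smul' := fun a x => by ext i; by_cases h : (i : ℕ) < k <;> simp [h] }

variable {k : ℕ} (x y : EuclideanSpace ℝ (Fin n))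

lemma headProj_apply (i : Fin n) : headProj n k x i = if (i : ℕ) < k then x i else 0 := rfl

lemma tailProj_apply (i : Fin n) : tailProj n k x i = if (i : ℕ) < k then 0 else x i := rfl

lemma headProj_add_tailProj : headProj n k x + tailProj n k x = x := by
  ext i
  rw [PiLp.add_apply, headProj_apply, tailProj_apply]
  split_ifs <;> simp

lemma inner_headProj_tailProj : ⟪headProj n k x, tailProj n k y⟫ = 0 := by
  rw [PiLp.inner_apply]
  refine Finset.sum_eq_zero fun i _ => ?_
  rw [headProj_apply, tailProj_apply]
  split_ifs <;> simp

lemma inner_headProj_headProj : ⟪headProj n k x, headProj n k y⟫ = ⟪headProj n k x, y⟫ := by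
  conv_rhs => rw [← headProj_add_tailProj (k := k) y]
  rw [inner_add_right, inner_headProj_tailProj, add_zero]

lemma inner_tailProj_tailProj : ⟪tailProj n k x, tailProj n k y⟫ = ⟪tailProj n k x, y⟫ := by
  conv_rhs => rw [← headProj_add_tailProj (k := k) y]
  rw [inner_add_right, real_inner_comm (headProj n k y), inner_headProj_tailProj, zero_add]

lemma norm_sq_headProj_add_tailProj :
    ‖headProj n k x‖ ^ 2 + ‖tailProj n k x‖ ^ 2 = ‖x‖ ^ 2 := by
  conv_rhs => rw [← headProj_add_tailProj (k := k) x]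
  rw [norm_add_sq_real, inner_headProj_tailProj]
  ring

lemma norm_headProj_le : ‖headProj n k x‖ ≤ ‖x‖ := by
  have := norm_sq_headProj_add_tailProj (k := k) x
  exact le_of_sq_le_sq (by nlinarith [sq_nonneg ‖tailProj n k x‖]) (norm_nonneg _)

lemma norm_tailProj_le : ‖tailProj n k x‖ ≤ ‖x‖ := by
  have := norm_sq_headProj_add_tailProj (k := k) x
  exact le_of_sq_le_sq (by nlinarith [sq_nonneg ‖headProj n k x‖]) (norm_nonneg _)

lemma mem_coordSubspace_iff : x ∈ coordSubspace n k ↔ tailProj n k x = 0 := by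
  constructor
  · intro h
    ext i
    rw [tailProj_apply]
    split_ifs with hi
    · rfl
    · exact h i (not_lt.1 hi)
  · intro h i hi
    have : tailProj n k x i = 0 := by rw [h]; rfl
    rwa [tailProj_apply, if_neg (not_lt.2 hi)] at this

lemma headProj_mem_coordSubspace : headProj n k x ∈ coordSubspace n k := fun i hi => by
  rw [headProj_apply, if_neg (not_lt.2 hi)]

lemma infDist_coordSubspace : infDist x (coordSubspace n k) = ‖tailProj n k x‖ := by
  have hx : x - headProj n k x = tailProj n k x :=
    sub_eq_of_eq_add' (headProj_add_tailProj x).symm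
  refine le_antisymm ?_ ?_
  · rw [← hx, ← dist_eq_norm]
    exact infDist_le_dist_of_mem (headProj_mem_coordSubspace x)
  · refine (le_infDist ⟨0, (coordSubspace n k).zero_mem⟩).2 fun y hy => ?_
    have h1 : tailProj n k (x - y) = tailProj n k x := by
      rw [map_sub, (mem_coordSubspace_iff y).1 hy, sub_zero]
    rw [dist_eq_norm, ← h1]
    exact norm_tailProj_le _

/-- The determinant of a block-scalar map perturbed by a symmetric map of rank at most two. -/
lemma det_blockScalar_add_rankTwo {α β c₁ c₂ c₃ : ℝ} (hα : α ≠ 0) (hβ : β ≠ 0)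
    (hk : 1 ≤ k) (hkn : k < n)
    {L : EuclideanSpace ℝ (Fin n) →L[ℝ] EuclideanSpace ℝ (Fin n)}
    (hL : ∀ h, L h = α • headProj n k h + β • tailProj n k h +
      (c₁ * ⟪headProj n k x, h⟫ + c₂ * ⟪tailProj n k x, h⟫) • headProj n k x +
      (c₂ * ⟪headProj n k x, h⟫ + c₃ * ⟪tailProj n k x, h⟫) • tailProj n k x) :
    L.det = α ^ (k - 1) * β ^ (n - k - 1) *
      ((α + c₁ * ‖headProj n k x‖ ^ 2) * (β + c₃ * ‖tailProj n k x‖ ^ 2) -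
        c₂ ^ 2 * ‖headProj n k x‖ ^ 2 * ‖tailProj n k x‖ ^ 2) := by
  set a := headProj n k x with ha
  set b := tailProj n k x with hb
  let d : Fin n → ℝ := fun i => if (i : ℕ) < k then α else β
  let U : Matrix (Fin n) (Fin 2) ℝ := Matrix.of fun i => ![a i / α, b i / β]
  let V : Matrix (Fin 2) (Fin n) ℝ :=
    Matrix.of ![fun j => c₁ * a j + c₂ * b j, fun j => c₂ * a j + c₃ * b j]
  have hM : LinearMap.toMatrix (EuclideanSpace.basisFun (Fin n) ℝ).toBasis
      (EuclideanSpace.basisFun (Fin n) ℝ).toBasis (L : EuclideanSpace ℝ (Fin n) →ₗ[ℝ] _) =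
      Matrix.diagonal d * (1 + U * V) := by
    ext i j
    rw [LinearMap.toMatrix_apply, Matrix.diagonal_mul, Matrix.add_apply, Matrix.mul_apply,
      Fin.sum_univ_two]
    simp only [OrthonormalBasis.coe_toBasis, OrthonormalBasis.coe_toBasis_repr_apply,
      EuclideanSpace.basisFun_apply, EuclideanSpace.basisFun_repr, ContinuousLinearMap.coe_coe]
    rw [hL]
    have e1 : ⟪a, EuclideanSpace.single j (1 : ℝ)⟫ = a j := by
      rw [EuclideanSpace.inner_single_right]; simp
    have e2 : ⟪b, EuclideanSpace.single j (1 : ℝ)⟫ = b j := by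
      rw [EuclideanSpace.inner_single_right]; simp
    rw [e1, e2]
    simp only [PiLp.add_apply, PiLp.smul_apply, smul_eq_mul, headProj_apply, tailProj_apply,
      U, V, d, Matrix.of_apply, Matrix.cons_val_zero, Matrix.cons_val_one, Matrix.one_apply,
      PiLp.single_apply]
    have ai : ¬ (i : ℕ) < k → a i = 0 := fun h => by rw [ha, headProj_apply, if_neg h]
    have bi : (i : ℕ) < k → b i = 0 := fun h => by rw [hb, tailProj_apply, if_pos h]
    by_cases hi : (i : ℕ) < k
    · simp only [hi, if_true, bi hi]
      field_simp
      split_ifs <;> ring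
    · simp only [hi, if_false, ai hi]
      field_simp
      split_ifs <;> ring
  have hdet : L.det = ((Matrix.diagonal d) * (1 + U * V)).det := by
    rw [← hM, LinearMap.det_toMatrix]
  have hsq : ∀ z : EuclideanSpace ℝ (Fin n), ∑ i, z i * z i = ‖z‖ ^ 2 := fun z => by
    rw [EuclideanSpace.norm_sq_eq]
    exact Finset.sum_congr rfl fun i _ => by rw [Real.norm_eq_abs, sq_abs, pow_two]
  have hab : ∑ i, a i * b i = 0 := by
    have := inner_headProj_tailProj (k := k) x x
    rw [PiLp.inner_apply] at this
    rw [← this]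
    exact Finset.sum_congr rfl fun i _ => by simp [a, b, mul_comm]
  have hVU : V * U = !![c₁ * ‖a‖ ^ 2 / α, c₂ * ‖b‖ ^ 2 / β; c₂ * ‖a‖ ^ 2 / α,
      c₃ * ‖b‖ ^ 2 / β] := by
    have key : ∀ (p r e : ℝ) (z : EuclideanSpace ℝ (Fin n)),
        ∑ i, (p * a i + r * b i) * (z i / e) =
          (p * ∑ i, a i * z i + r * ∑ i, b i * z i) / e := by
      intro p r e z
      rw [Finset.mul_sum, Finset.mul_sum, ← Finset.sum_add_distrib, Finset.sum_div]
      exact Finset.sum_congr rfl fun i _ => by ring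
    have hba : ∑ i, b i * a i = 0 := by simpa only [mul_comm] using hab
    ext i j
    fin_cases i <;> fin_cases j <;>
      simp [Matrix.mul_apply, U, V, key, hsq, hab, hba]
  have hdiag : ∏ i, d i = α ^ k * β ^ (n - k) := by
    have h1 : (Finset.univ.filter fun i : Fin n => (i : ℕ) < k).card = k := by
      rw [Fin.card_filter_val_lt]
      exact min_eq_right hkn.le
    have h2 : (Finset.univ.filter fun i : Fin n => ¬ (i : ℕ) < k).card = n - k := by
      have := Finset.card_filter_add_card_filter_not (s := (Finset.univ : Finset (Fin n)))
        (fun i : Fin n => (i : ℕ) < k)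
      rw [h1, Finset.card_univ, Fintype.card_fin] at this
      omega
    simp only [d]
    rw [Finset.prod_ite, Finset.prod_const, Finset.prod_const, h1, h2]
  rw [hdet, Matrix.det_mul, Matrix.det_diagonal, Matrix.det_one_add_mul_comm, hVU, hdiag,
    Matrix.det_fin_two]
  simp only [Matrix.add_apply, Matrix.one_apply_eq, Matrix.of_apply, Matrix.cons_val_zero,
    Matrix.cons_val_one, Matrix.cons_val', ne_eq, Matrix.one_apply_ne, zero_ne_one, one_ne_zero,
    not_false_eq_true, zero_add, Matrix.cons_val_fin_one]
  obtain ⟨k', rfl⟩ : ∃ k', k = k' + 1 := ⟨k - 1, by omega⟩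
  obtain ⟨l, hl⟩ : ∃ l, n - (k' + 1) = l + 1 := ⟨n - (k' + 1) - 1, by omega⟩
  rw [hl, Nat.add_sub_cancel, Nat.add_sub_cancel, pow_succ, pow_succ]
  field_simp

end Projections

/-! ### Tangent inequalities for powers -/

section RealInequalities

variable {a b r ρ s σ : ℝ}

lemma rpow_tangent_le (ha : 0 < a) (hb : 0 ≤ b) (hs : 1 ≤ s) :
    a ^ s + s * a ^ (s - 1) * (b - a) ≤ b ^ s := by
  have h1 := one_add_mul_self_le_rpow_one_add (s := b / a - 1) (by
    have : 0 ≤ b / a := by positivity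
    linarith) hs
  rw [add_sub_cancel, Real.div_rpow hb ha.le, le_div_iff₀ (by positivity)] at h1
  have h2 : a ^ s = a ^ (s - 1) * a := by
    rw [← Real.rpow_add_one ha.ne', sub_add_cancel]
  rw [h2] at h1 ⊢
  have h3 : (1 + s * (b / a - 1)) * (a ^ (s - 1) * a) =
      a ^ (s - 1) * a + s * a ^ (s - 1) * (b - a) := by field_simp
  linarith

lemma rpow_tangent_lt (ha : 0 < a) (hb : 0 ≤ b) (hs : 1 < s) (hab : b ≠ a) :
    a ^ s + s * a ^ (s - 1) * (b - a) < b ^ s := by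
  have h1 := one_add_mul_self_lt_rpow_one_add (s := b / a - 1) (by
    have : 0 ≤ b / a := by positivity
    linarith) (by rwa [sub_ne_zero, ne_eq, div_eq_one_iff_eq ha.ne']) hs
  rw [add_sub_cancel, Real.div_rpow hb ha.le, lt_div_iff₀ (by positivity)] at h1
  have h2 : a ^ s = a ^ (s - 1) * a := by
    rw [← Real.rpow_add_one ha.ne', sub_add_cancel]
  rw [h2] at h1 ⊢
  have h3 : (1 + s * (b / a - 1)) * (a ^ (s - 1) * a) =
      a ^ (s - 1) * a + s * a ^ (s - 1) * (b - a) := by field_simp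
  linarith

/-- Tangent planes of the convex function `(b, r) ↦ b ^ σ * r ^ (1 - σ)`, the perspective of
`b ^ σ`. -/
lemma perspective_tangent_le (ha : 0 < a) (hb : 0 ≤ b) (hρ : 0 < ρ) (hr : 0 < r) (hσ : 1 ≤ σ) :
    σ * a ^ (σ - 1) * ρ ^ (1 - σ) * b - (σ - 1) * (a ^ σ * ρ ^ (-σ)) * r ≤
      b ^ σ * r ^ (1 - σ) := by
  have h1 := mul_le_mul_of_nonneg_left
    (rpow_tangent_le (div_pos ha hρ) (div_nonneg hb hr.le) hσ) hr.le
  rw [Real.div_rpow ha.le hρ.le, Real.div_rpow hb hr.le, Real.div_rpow ha.le hρ.le] at h1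
  have e1 : r ^ (1 - σ) = r / r ^ σ := by rw [Real.rpow_sub hr, Real.rpow_one]
  have e2 : ρ ^ (1 - σ) = ρ / ρ ^ σ := by rw [Real.rpow_sub hρ, Real.rpow_one]
  have e3 : ρ ^ (σ - 1) = ρ ^ σ / ρ := by rw [Real.rpow_sub hρ, Real.rpow_one]
  have e4 : a ^ (σ - 1) = a ^ σ / a := by rw [Real.rpow_sub ha, Real.rpow_one]
  have hρσ : 0 < ρ ^ σ := Real.rpow_pos_of_pos hρ _
  have hrσ : 0 < r ^ σ := Real.rpow_pos_of_pos hr _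
  rw [e3, e4] at h1
  rw [e1, e2, e4, Real.rpow_neg hρ.le]
  have h2 : r * (a ^ σ / ρ ^ σ + σ * (a ^ σ / a / (ρ ^ σ / ρ)) * (b / r - a / ρ)) =
      σ * (a ^ σ / a) * (ρ / ρ ^ σ) * b - (σ - 1) * (a ^ σ * (ρ ^ σ)⁻¹) * r := by
    field_simp
    ring
  have h3 : r * (b ^ σ / r ^ σ) = b ^ σ * (r / r ^ σ) := by ring
  linarith

end RealInequalities

/-! ### The model subsolution -/

section Subsolution

variable {n k : ℕ} {s σ : ℝ} {x y : EuclideanSpace ℝ (Fin n)}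

/-- The model subsolution `t ^ s + t ^ σ * (2 - r ^ 2) ^ (1 - σ)`, where `t` is the distance to the
coordinate subspace `ℝᵏ` and `r` is the norm of the projection onto it. The first term gives the
growth, the second one makes the function strictly convex. -/
noncomputable def modelFn (k : ℕ) (s σ : ℝ) (x : EuclideanSpace ℝ (Fin n)) : ℝ :=
  ‖tailProj n k x‖ ^ s + ‖tailProj n k x‖ ^ σ * (2 - ‖headProj n k x‖ ^ 2) ^ (1 - σ)

/-- The coefficient of `headProj` in the gradient of `modelFn`. -/
noncomputable def headCoeff (k : ℕ) (σ : ℝ) (x : EuclideanSpace ℝ (Fin n)) : ℝ :=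
  2 * (σ - 1) * (‖tailProj n k x‖ ^ σ * (2 - ‖headProj n k x‖ ^ 2) ^ (-σ))

/-- The coefficient of `tailProj` in the gradient of `modelFn`. -/
noncomputable def tailCoeff (k : ℕ) (s σ : ℝ) (x : EuclideanSpace ℝ (Fin n)) : ℝ :=
  s * ‖tailProj n k x‖ ^ (s - 2) +
    σ * (‖tailProj n k x‖ ^ (σ - 2) * (2 - ‖headProj n k x‖ ^ 2) ^ (1 - σ))

/-- The gradient of `modelFn` away from `ℝᵏ`. -/
noncomputable def modelGrad (k : ℕ) (s σ : ℝ) (x : EuclideanSpace ℝ (Fin n)) :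
    EuclideanSpace ℝ (Fin n) :=
  headCoeff k σ x • headProj n k x + tailCoeff k s σ x • tailProj n k x

lemma one_le_two_sub_norm_sq (hx : ‖x‖ ≤ 1) : 1 ≤ 2 - ‖headProj n k x‖ ^ 2 := by
  have := pow_le_one₀ (n := 2) (norm_nonneg _) ((norm_headProj_le (k := k) x).trans hx)
  linarith

/-- Strict convexity of the model subsolution at points off `ℝᵏ`. -/
lemma modelFn_tangent_lt (hs : 1 ≤ s) (hσ : 1 < σ) (hx : ‖x‖ ≤ 1) (hy : ‖y‖ ≤ 1)
    (hxk : x ∉ coordSubspace n k) (hxy : y ≠ x) :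
    modelFn k s σ x + ⟪modelGrad k s σ x, y - x⟫ < modelFn k s σ y := by
  have ha : 0 < ‖tailProj n k x‖ := norm_pos_iff.2 fun h => hxk ((mem_coordSubspace_iff x).2 h)
  have hρ : 0 < 2 - ‖headProj n k x‖ ^ 2 := one_pos.trans_le (one_le_two_sub_norm_sq hx)
  have hr : 0 < 2 - ‖headProj n k y‖ ^ 2 := one_pos.trans_le (one_le_two_sub_norm_sq hy)
  have hb : 0 ≤ ‖tailProj n k y‖ := norm_nonneg _
  have hin : ⟪modelGrad k s σ x, y - x⟫ =
      headCoeff k σ x * (⟪headProj n k x, headProj n k y⟫ - ‖headProj n k x‖ ^ 2) +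
      tailCoeff k s σ x * (⟪tailProj n k x, tailProj n k y⟫ - ‖tailProj n k x‖ ^ 2) := by
    rw [modelGrad, inner_add_left, real_inner_smul_left, real_inner_smul_left,
      ← inner_headProj_headProj, ← inner_tailProj_tailProj, map_sub, map_sub, inner_sub_right,
      inner_sub_right, real_inner_self_eq_norm_sq, real_inner_self_eq_norm_sq]
  have hsq : ‖headProj n k x - headProj n k y‖ ^ 2 = ‖headProj n k x‖ ^ 2 -
      2 * ⟪headProj n k x, headProj n k y⟫ + ‖headProj n k y‖ ^ 2 := norm_sub_sq_real _ _
  have hsqt : ‖tailProj n k x - tailProj n k y‖ ^ 2 = ‖tailProj n k x‖ ^ 2 -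
      2 * ⟪tailProj n k x, tailProj n k y⟫ + ‖tailProj n k y‖ ^ 2 := norm_sub_sq_real _ _
  have hcs := real_inner_le_norm (tailProj n k x) (tailProj n k y)
  have hdecomp := headProj_add_tailProj (n := n) (k := k)
  rw [hin]
  unfold modelFn headCoeff tailCoeff
  set p := ⟪headProj n k x, headProj n k y⟫
  set τ := ⟪tailProj n k x, tailProj n k y⟫
  set a := ‖tailProj n k x‖
  set b := ‖tailProj n k y‖
  set ρ := 2 - ‖headProj n k x‖ ^ 2 with hρdef
  set r := 2 - ‖headProj n k y‖ ^ 2 with hrdef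
  have e1 : a ^ (s - 1) = a ^ (s - 2) * a := by
    rw [← Real.rpow_add_one ha.ne']; ring_nf
  have e2 : a ^ (σ - 1) = a ^ (σ - 2) * a := by
    rw [← Real.rpow_add_one ha.ne']; ring_nf
  have e3 : a ^ σ = a ^ (σ - 2) * a ^ 2 := by
    rw [← Real.rpow_natCast, ← Real.rpow_add ha]; norm_num
  have e4 : ρ ^ (1 - σ) = ρ ^ (-σ) * ρ := by
    rw [← Real.rpow_add_one hρ.ne']; ring_nf
  have t1 := rpow_tangent_le ha hb hs
  have t2 := perspective_tangent_le ha hb hρ hr hσ.le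
  have hA : 0 < a ^ (σ - 2) := Real.rpow_pos_of_pos ha _
  have hS : 0 < a ^ (s - 2) := Real.rpow_pos_of_pos ha _
  have hR : 0 < ρ ^ (-σ) := Real.rpow_pos_of_pos hρ _
  rw [e1] at t1
  rw [e2, e4, e3] at t2
  rw [e4, e3]
  have hQ : 0 ≤ s * a ^ (s - 2) + σ * (a ^ (σ - 2) * (ρ ^ (-σ) * ρ)) := by positivity
  -- the three sources of strictness
  have key : (s * a ^ (s - 2) + σ * (a ^ (σ - 2) * (ρ ^ (-σ) * ρ))) * (a * b - τ) +
      (σ - 1) * (a ^ (σ - 2) * a ^ 2 * ρ ^ (-σ)) * ‖headProj n k x - headProj n k y‖ ^ 2 +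
      (b ^ σ * r ^ (1 - σ) - (σ * (a ^ (σ - 2) * a) * (ρ ^ (-σ) * ρ) * b -
        (σ - 1) * (a ^ (σ - 2) * a ^ 2 * ρ ^ (-σ)) * r)) > 0 := by
    have k1 : 0 ≤ (s * a ^ (s - 2) + σ * (a ^ (σ - 2) * (ρ ^ (-σ) * ρ))) * (a * b - τ) :=
      mul_nonneg hQ (sub_nonneg.2 hcs)
    have hc : 0 < (σ - 1) * (a ^ (σ - 2) * a ^ 2 * ρ ^ (-σ)) :=
      mul_pos (sub_pos.2 hσ) (by positivity)
    by_cases hh : headProj n k x = headProj n k y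
    · by_cases hab : b = a
      · have hτ : τ < a * b := by
          have hne : tailProj n k x - tailProj n k y ≠ 0 := fun h => hxy (by
            rw [← hdecomp x, ← hdecomp y, hh, sub_eq_zero.1 h])
          have := pow_pos (norm_pos_iff.2 hne) 2
          rw [hsqt, hab] at this
          rw [hab]
          linarith
        have k2 : 0 < (s * a ^ (s - 2) + σ * (a ^ (σ - 2) * (ρ ^ (-σ) * ρ))) * (a * b - τ) :=
          mul_pos (by positivity) (sub_pos.2 hτ)
        have k3 := mul_nonneg hc.le (sq_nonneg ‖headProj n k x - headProj n k y‖)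
        linarith
      · have hrρ : r = ρ := by rw [hrdef, hρdef, hh]
        have t3 := rpow_tangent_lt ha hb hσ hab
        have t4 := mul_lt_mul_of_pos_right t3 (Real.rpow_pos_of_pos hρ (1 - σ))
        rw [e2, e3, e4] at t4
        have k3 := mul_nonneg hc.le (sq_nonneg ‖headProj n k x - headProj n k y‖)
        rw [hrρ, e4]
        linear_combination t4 + k1 + k3
    · have k2 : 0 < ‖headProj n k x - headProj n k y‖ ^ 2 :=
        pow_pos (norm_pos_iff.2 (sub_ne_zero.2 hh)) 2
      have k3 := mul_pos hc k2
      linarith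
  rw [hsq] at key
  have hx2 : ‖headProj n k x‖ ^ 2 = 2 - ρ := by rw [hρdef]; ring
  have hy2 : ‖headProj n k y‖ ^ 2 = 2 - r := by rw [hrdef]; ring
  rw [hx2, hy2] at key
  rw [hx2]
  have e5 : a ^ s = a ^ (s - 2) * a ^ 2 := by
    rw [← Real.rpow_natCast, ← Real.rpow_add ha]; norm_num
  rw [e5] at t1 ⊢
  linear_combination t1 + key

/-- The gradient of the model subsolution is injective on the unit ball away from `ℝᵏ`. -/
lemma injOn_modelGrad (hs : 1 ≤ s) (hσ : 1 < σ) :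
    InjOn (modelGrad (n := n) k s σ) (closedBall 0 1 \ coordSubspace n k) := by
  intro x hx y hy hxy
  by_contra hne
  have h1 := modelFn_tangent_lt hs hσ (mem_closedBall_zero_iff.1 hx.1)
    (mem_closedBall_zero_iff.1 hy.1) hx.2 (Ne.symm hne)
  have h2 := modelFn_tangent_lt hs hσ (mem_closedBall_zero_iff.1 hy.1)
    (mem_closedBall_zero_iff.1 hx.1) hy.2 hne
  rw [hxy, inner_sub_right] at h1
  rw [inner_sub_right] at h2
  linarith

end Subsolution

/-! ### The Hessian determinant of the model subsolution -/

section Hessian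

variable {n k : ℕ} {s σ : ℝ} {x : EuclideanSpace ℝ (Fin n)}

lemma hasFDerivAt_norm_tailProj_rpow (e : ℝ) (hx : tailProj n k x ≠ 0) :
    HasFDerivAt (fun y => ‖tailProj n k y‖ ^ e)
      ((e * ‖tailProj n k x‖ ^ (e - 2)) • innerSL ℝ (tailProj n k x)) x := by
  have ht : 0 < ‖tailProj n k x‖ := norm_pos_iff.2 hx
  have h := ((tailProj n k).hasFDerivAt (x := x)).norm_sq.rpow_const (p := e / 2)
    (Or.inl (pow_pos ht 2).ne')
  have hpow : ∀ y : EuclideanSpace ℝ (Fin n), ∀ c : ℝ,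
      (‖tailProj n k y‖ ^ 2) ^ (c / 2) = ‖tailProj n k y‖ ^ c := fun y c => by
    rw [← Real.rpow_natCast, ← Real.rpow_mul (norm_nonneg _)]
    congr 1
    push_cast
    ring
  simp_rw [hpow] at h
  refine h.congr_fderiv ?_
  ext z
  have e1 : e / 2 - 1 = (e - 2) / 2 := by ring
  rw [e1, hpow]
  simp only [smul_apply, ContinuousLinearMap.comp_apply, innerSL_apply_apply,
    smul_eq_mul, nsmul_eq_mul, inner_tailProj_tailProj]
  push_cast
  ring

lemma hasFDerivAt_two_sub_rpow (e : ℝ) (hx : ‖x‖ ≤ 1) :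
    HasFDerivAt (fun y => (2 - ‖headProj n k y‖ ^ 2) ^ e)
      ((-2 * e * (2 - ‖headProj n k x‖ ^ 2) ^ (e - 1)) • innerSL ℝ (headProj n k x)) x := by
  have hρ : 0 < 2 - ‖headProj n k x‖ ^ 2 := one_pos.trans_le (one_le_two_sub_norm_sq hx)
  have h := (((headProj n k).hasFDerivAt (x := x)).norm_sq.const_sub 2).rpow_const (p := e)
    (Or.inl hρ.ne')
  refine h.congr_fderiv ?_
  ext z
  simp only [smul_apply, neg_apply,
    ContinuousLinearMap.comp_apply, innerSL_apply_apply,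
    smul_eq_mul, nsmul_eq_mul, inner_headProj_headProj]
  push_cast
  ring

/-- The derivative of the gradient of the model subsolution is a block-scalar map perturbed by a
symmetric map of rank two, so its determinant is explicit. -/
lemma exists_hasFDerivAt_modelGrad (hs : 0 < s) (hσ : 1 < σ) (hx : ‖x‖ ≤ 1)
    (hxk : tailProj n k x ≠ 0) (hk : 1 ≤ k) (hkn : k < n) :
    ∃ L, HasFDerivAt (modelGrad (n := n) k s σ) L x ∧
      L.det = headCoeff k σ x ^ (k - 1) * tailCoeff k s σ x ^ (n - k - 1) *
        ((headCoeff k σ x + 4 * σ * (σ - 1) * (‖tailProj n k x‖ ^ σ *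
            (2 - ‖headProj n k x‖ ^ 2) ^ (-σ - 1)) * ‖headProj n k x‖ ^ 2) *
          (tailCoeff k s σ x + (s * (s - 2) * ‖tailProj n k x‖ ^ (s - 2 - 2) +
            σ * (σ - 2) * (‖tailProj n k x‖ ^ (σ - 2 - 2) *
              (2 - ‖headProj n k x‖ ^ 2) ^ (1 - σ))) * ‖tailProj n k x‖ ^ 2) -
          (2 * σ * (σ - 1) * (‖tailProj n k x‖ ^ (σ - 2) *
            (2 - ‖headProj n k x‖ ^ 2) ^ (-σ))) ^ 2 *
            ‖headProj n k x‖ ^ 2 * ‖tailProj n k x‖ ^ 2) := by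
  have ht : 0 < ‖tailProj n k x‖ := norm_pos_iff.2 hxk
  have hρ : 0 < 2 - ‖headProj n k x‖ ^ 2 := one_pos.trans_le (one_le_two_sub_norm_sq hx)
  have hα := ((hasFDerivAt_norm_tailProj_rpow σ hxk).mul
    (hasFDerivAt_two_sub_rpow (k := k) (-σ) hx)).const_mul (2 * (σ - 1))
  have hβ := ((hasFDerivAt_norm_tailProj_rpow (s - 2) hxk).const_mul s).add
    (((hasFDerivAt_norm_tailProj_rpow (σ - 2) hxk).mul
      (hasFDerivAt_two_sub_rpow (k := k) (1 - σ) hx)).const_mul σ)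
  have hL := (hα.smul (headProj n k).hasFDerivAt).add (hβ.smul (tailProj n k).hasFDerivAt)
  have hα0 : headCoeff k σ x ≠ 0 := by
    have : 0 < headCoeff k σ x := mul_pos (mul_pos two_pos (sub_pos.2 hσ))
      (mul_pos (Real.rpow_pos_of_pos ht _) (Real.rpow_pos_of_pos hρ _))
    exact this.ne'
  have hβ0 : tailCoeff k s σ x ≠ 0 := by
    have : 0 < tailCoeff k s σ x := add_pos (mul_pos hs (Real.rpow_pos_of_pos ht _))
      (mul_pos (by linarith) (mul_pos (Real.rpow_pos_of_pos ht _) (Real.rpow_pos_of_pos hρ _)))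
    exact this.ne'
  refine ⟨_, hL, det_blockScalar_add_rankTwo x hα0 hβ0 hk hkn fun h => ?_⟩
  have e1 : (1 : ℝ) - σ - 1 = -σ := by ring
  simp only [add_apply, smul_apply,
    ContinuousLinearMap.smulRight_apply, innerSL_apply_apply, smul_eq_mul, e1]
  unfold headCoeff tailCoeff
  simp only [Pi.mul_apply, Pi.add_apply]
  module

/-- Lower bound for the Hessian determinant of the model subsolution. -/
lemma exists_hasFDerivAt_le_det (hs : 1 ≤ s) (hσ : 1 < σ) (hx : ‖x‖ ≤ 1)
    (hxk : tailProj n k x ≠ 0) (hk : 1 ≤ k) (hkn : k < n) :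
    ∃ L, HasFDerivAt (modelGrad (n := n) k s σ) L x ∧
      (2 * (σ - 1) * 2 ^ (-σ)) ^ (k - 1) * (2 * σ * (σ - 1) ^ 2 * 2 ^ (1 - 2 * σ)) *
        ‖tailProj n k x‖ ^ (σ * ((k : ℝ) - 1) + (s - 2) * ((n : ℝ) - k - 1) + (2 * σ - 2)) ≤
        L.det := by
  obtain ⟨L, hL, hdet⟩ := exists_hasFDerivAt_modelGrad (one_pos.trans_le hs) hσ hx hxk hk hkn
  refine ⟨L, hL, ?_⟩
  rw [hdet]
  have ht : 0 < ‖tailProj n k x‖ := norm_pos_iff.2 hxk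
  have hρ1 := one_le_two_sub_norm_sq (k := k) hx
  have hρ2 : 2 - ‖headProj n k x‖ ^ 2 ≤ 2 := by linarith [sq_nonneg ‖headProj n k x‖]
  have hr0 : 0 ≤ ‖headProj n k x‖ ^ 2 := sq_nonneg _
  unfold headCoeff tailCoeff
  set r := ‖headProj n k x‖
  set t := ‖tailProj n k x‖
  set ρ := 2 - r ^ 2
  have hρ : 0 < ρ := one_pos.trans_le hρ1
  have e1 : t ^ (s - 2 - 2) * t ^ 2 = t ^ (s - 2) := by
    rw [← Real.rpow_natCast, ← Real.rpow_add ht]; norm_num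
  have e2 : t ^ (σ - 2 - 2) * t ^ 2 = t ^ (σ - 2) := by
    rw [← Real.rpow_natCast, ← Real.rpow_add ht]; norm_num
  have e3 : t ^ σ = t ^ (σ - 2) * t ^ 2 := by
    rw [← Real.rpow_natCast, ← Real.rpow_add ht]; norm_num
  have e4 : ρ ^ (1 - σ) = ρ ^ (-σ - 1) * ρ ^ 2 := by
    rw [← Real.rpow_natCast, ← Real.rpow_add hρ]; congr 1; push_cast; ring
  have e5 : ρ ^ (-σ) = ρ ^ (-σ - 1) * ρ := by
    rw [← Real.rpow_add_one hρ.ne', sub_add_cancel]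
  have e6 : t ^ (2 * σ - 2) = t ^ (σ - 2) * t ^ (σ - 2) * t ^ 2 := by
    rw [← Real.rpow_natCast, ← Real.rpow_add ht, ← Real.rpow_add ht]; congr 1; push_cast; ring
  have e7 : ρ ^ (1 - 2 * σ) = ρ ^ (-σ - 1) * ρ ^ (-σ - 1) * ρ ^ 3 := by
    rw [← Real.rpow_natCast, ← Real.rpow_add hρ, ← Real.rpow_add hρ]; congr 1; push_cast; ring
  have hS : 0 < t ^ (s - 2) := Real.rpow_pos_of_pos ht _
  have hP : 0 < t ^ (σ - 2) := Real.rpow_pos_of_pos ht _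
  have hR : 0 < ρ ^ (-σ - 1) := Real.rpow_pos_of_pos hρ _
  have hσ1 : 0 < σ - 1 := sub_pos.2 hσ
  have hσ0 : 0 < σ := one_pos.trans hσ
  -- the three factors
  have f1 : 2 * (σ - 1) * 2 ^ (-σ) * t ^ σ ≤ 2 * (σ - 1) * (t ^ σ * ρ ^ (-σ)) := by
    rw [mul_assoc (2 * (σ - 1)), mul_comm (2 ^ (-σ)) (t ^ σ)]
    have := Real.rpow_le_rpow_of_nonpos hρ hρ2 (show -σ ≤ 0 by linarith)
    gcongr
  have f2 : t ^ (s - 2) ≤ s * t ^ (s - 2) + σ * (t ^ (σ - 2) * ρ ^ (1 - σ)) := by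
    have h1 : 1 * t ^ (s - 2) ≤ s * t ^ (s - 2) := by gcongr
    have h2 : 0 ≤ σ * (t ^ (σ - 2) * ρ ^ (1 - σ)) := by positivity
    linarith
  have f3 : 2 * σ * (σ - 1) ^ 2 * 2 ^ (1 - 2 * σ) * t ^ (2 * σ - 2) ≤
      (2 * (σ - 1) * (t ^ σ * ρ ^ (-σ)) +
        4 * σ * (σ - 1) * (t ^ σ * ρ ^ (-σ - 1)) * r ^ 2) *
      (s * t ^ (s - 2) + σ * (t ^ (σ - 2) * ρ ^ (1 - σ)) + (s * (s - 2) * t ^ (s - 2 - 2) +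
        σ * (σ - 2) * (t ^ (σ - 2 - 2) * ρ ^ (1 - σ))) * t ^ 2) -
      (2 * σ * (σ - 1) * (t ^ (σ - 2) * ρ ^ (-σ))) ^ 2 * r ^ 2 * t ^ 2 := by
    have h1 := Real.rpow_le_rpow_of_nonpos hρ hρ2 (show 1 - 2 * σ ≤ 0 by linarith)
    have h2 : 2 * σ * (σ - 1) ^ 2 * 2 ^ (1 - 2 * σ) * t ^ (2 * σ - 2) ≤
        2 * σ * (σ - 1) ^ 2 * ρ ^ (1 - 2 * σ) * t ^ (2 * σ - 2) := by gcongr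
    refine h2.trans ?_
    have h3 : s * t ^ (s - 2) + σ * (t ^ (σ - 2) * ρ ^ (1 - σ)) + (s * (s - 2) * t ^ (s - 2 - 2) +
        σ * (σ - 2) * (t ^ (σ - 2 - 2) * ρ ^ (1 - σ))) * t ^ 2 =
        s * (s - 1) * t ^ (s - 2) + σ * (σ - 1) * (t ^ (σ - 2) * ρ ^ (1 - σ)) := by
      rw [← e1, ← e2]; ring
    rw [h3, e3, e4, e5, e6, e7]
    have h4 : 0 ≤ (2 * (σ - 1) * (t ^ (σ - 2) * t ^ 2 * (ρ ^ (-σ - 1) * ρ)) +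
        4 * σ * (σ - 1) * (t ^ (σ - 2) * t ^ 2 * ρ ^ (-σ - 1)) * r ^ 2) *
        (s * (s - 1) * t ^ (s - 2)) :=
      mul_nonneg (by positivity) (mul_nonneg (mul_nonneg (by linarith) (by linarith)) hS.le)
    linear_combination h4
  have hexp : t ^ (σ * ((k : ℝ) - 1) + (s - 2) * ((n : ℝ) - k - 1) + (2 * σ - 2)) =
      (t ^ σ) ^ (k - 1) * (t ^ (s - 2)) ^ (n - k - 1) * t ^ (2 * σ - 2) := by
    rw [Real.rpow_add ht, Real.rpow_add ht, Real.rpow_mul ht.le, Real.rpow_mul ht.le]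
    congr 2
    · rw [← Real.rpow_natCast, Nat.cast_sub hk, Nat.cast_one]
    · rw [← Real.rpow_natCast, Nat.sub_sub, Nat.cast_sub (by omega)]
      push_cast
      ring_nf
  rw [hexp]
  have g1 := pow_le_pow_left₀ (by positivity) f1 (k - 1)
  have g2 := pow_le_pow_left₀ hS.le f2 (n - k - 1)
  have g3 := mul_le_mul (mul_le_mul g1 g2 (by positivity) (by positivity)) f3 (by positivity)
    (by positivity)
  refine le_trans (le_of_eq ?_) g3
  rw [mul_pow (2 * (σ - 1) * 2 ^ (-σ)) (t ^ σ)]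
  ring

end Hessian

/-! ### Comparison principle -/

section Comparison

variable {n : ℕ} {u v F : EuclideanSpace ℝ (Fin n) → ℝ}
  {G : EuclideanSpace ℝ (Fin n) → EuclideanSpace ℝ (Fin n)} {S : Set (EuclideanSpace ℝ (Fin n))}

/-- If the graph of `v` dips below that of `u`, then sliding a supporting plane of `u` down until it
touches `v` from below, it touches at a point where `v < u`. -/
lemma exists_mem_subdifferential_of_lt (hv : ContinuousOn v (closedBall 0 1))
    (huv : ∀ x ∈ sphere 0 1, u x ≤ v x) {x p : EuclideanSpace ℝ (Fin n)} (hx : x ∈ ball 0 1)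
    (hxlt : v x < u x) (hp : ∀ y ∈ closedBall 0 1, u x + ⟪p, y - x⟫ ≤ u y) :
    ∃ z ∈ ball 0 1, v z < u z ∧ p ∈ subdifferential (ball 0 1) v z := by
  obtain ⟨z, hz, hmin⟩ := (isCompact_closedBall (0 : EuclideanSpace ℝ (Fin n)) 1).exists_isMinOn
    (nonempty_closedBall.2 zero_le_one) (f := fun y => v y - ⟪p, y - x⟫) (by fun_prop)
  have h1 := hmin (ball_subset_closedBall hx)
  simp only [mem_ofPred_eq, sub_self, inner_zero_right, sub_zero] at h1
  have h2 := hp z hz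
  have hzball : z ∈ ball 0 1 := by
    refine (mem_closedBall.1 hz).lt_of_ne fun h => ?_
    linarith [huv z h]
  refine ⟨z, hzball, by linarith, fun y hy => ?_⟩
  have h3 := hmin (ball_subset_closedBall hy)
  simp only [mem_ofPred_eq] at h3
  have h4 : y - z = (y - x) - (z - x) := by abel
  rw [h4, inner_sub_right]
  linarith

/-- Comparison principle: a strict subsolution `u` below `v` on the sphere is below `v` in the ball.
On the set where `v < u`, the Monge–Ampère measure of `v` would be at least that of `u`. -/
lemma le_of_strict_subsolution (hu : ContinuousOn u (closedBall 0 1))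
    (hv : ContinuousOn v (closedBall 0 1)) (huv : ∀ x ∈ sphere 0 1, u x ≤ v x)
    (hS : IsClosed S) (hSnull : volume S = 0)
    (hG : ∀ x ∈ ball 0 1 \ S, ∀ y ∈ closedBall 0 1, u x + ⟪G x, y - x⟫ ≤ u y)
    (hF : ∀ x ∈ ball 0 1 \ S, 0 < F x) {B : ℝ} (hFB : ∀ x ∈ ball 0 1, F x ≤ B)
    (hFm : Measurable F)
    (hGvol : ∀ D : Set (EuclideanSpace ℝ (Fin n)), IsOpen D → D ⊆ ball 0 1 →
      2 * ∫⁻ x in D \ S, ENNReal.ofReal (F x) ≤ volume (G '' (D \ S)))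
    (hvol : ∀ D : Set (EuclideanSpace ℝ (Fin n)), MeasurableSet D → D ⊆ ball 0 1 →
      (∀ x ∈ D, v x < u x) →
      mongeAmpereMeasure (ball 0 1) v D ≤ ∫⁻ x in D, ENNReal.ofReal (F x)) :
    ∀ x ∈ closedBall 0 1, u x ≤ v x := by
  intro x hx
  rcases (mem_closedBall.1 hx).lt_or_eq with hxb | hxs
  swap
  · exact huv x hxs
  by_contra hlt
  rw [not_le] at hlt
  set D := {y | y ∈ ball (0 : EuclideanSpace ℝ (Fin n)) 1 ∧ v y < u y} with hD
  have hDsub : D ⊆ ball 0 1 := fun y hy => hy.1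
  have hDopen : IsOpen D := by
    have h1 := ((hu.sub hv).mono ball_subset_closedBall).isOpen_inter_preimage
      isOpen_ball (isOpen_Ioi (a := (0 : ℝ)))
    convert h1 using 1
    ext y
    simp [hD]
  have hsub : G '' (D \ S) ⊆ ⋃ z ∈ D, subdifferential (ball 0 1) v z := by
    rintro _ ⟨y, hy, rfl⟩
    obtain ⟨z, hz, hzlt, hzp⟩ := exists_mem_subdifferential_of_lt hv huv hy.1.1 hy.1.2
      (hG y ⟨hy.1.1, hy.2⟩)
    exact mem_iUnion₂.2 ⟨z, ⟨hz, hzlt⟩, hzp⟩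
  have hDS : MeasurableSet (D \ S) := hDopen.measurableSet.diff hS.measurableSet
  have heq : ∫⁻ y in D, ENNReal.ofReal (F y) = ∫⁻ y in D \ S, ENNReal.ofReal (F y) :=
    setLIntegral_congr (sdiff_null_ae_eq_self hSnull).symm
  have hle : 2 * ∫⁻ y in D \ S, ENNReal.ofReal (F y) ≤ ∫⁻ y in D \ S, ENNReal.ofReal (F y) := by
    rw [← heq]
    refine (heq ▸ hGvol D hDopen hDsub).trans ((measure_mono hsub).trans ?_)
    exact hvol D hDopen.measurableSet hDsub fun y hy => hy.2
  have hfin : ∫⁻ y in D \ S, ENNReal.ofReal (F y) ≠ ⊤ := by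
    refine ((setLIntegral_mono' hDS fun y hy =>
      ENNReal.ofReal_le_ofReal (hFB y (hDsub hy.1))).trans_lt ?_).ne
    rw [setLIntegral_const]
    exact ENNReal.mul_lt_top ENNReal.ofReal_lt_top
      ((measure_mono (sdiff_subset.trans hDsub)).trans_lt measure_ball_lt_top)
  have hpos : 0 < ∫⁻ y in D \ S, ENNReal.ofReal (F y) := by
    rw [setLIntegral_pos_iff hFm.ennreal_ofReal]
    have hDpos : 0 < volume (D \ S) := by
      rw [measure_sdiff_null hSnull]
      exact hDopen.measure_pos _ ⟨x, hxb, hlt⟩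
    refine hDpos.trans_le (measure_mono fun y hy => ⟨?_, hy⟩)
    exact (ENNReal.ofReal_pos.2 (hF y ⟨hDsub hy.1, hy.2⟩)).ne'
  rw [two_mul] at hle
  exact absurd hle (not_le.2 (ENNReal.lt_add_right hfin hpos.ne'))

end Comparison

/-! ### Scaling of the model subsolution -/

section ModelSubsolution

variable {n k : ℕ} {q s σ : ℝ} {x : EuclideanSpace ℝ (Fin n)}

lemma rpow_le_modelFn (hx : ‖x‖ ≤ 1) : ‖tailProj n k x‖ ^ s ≤ modelFn k s σ x := by
  have := one_le_two_sub_norm_sq (k := k) hx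
  have : 0 ≤ ‖tailProj n k x‖ ^ σ * (2 - ‖headProj n k x‖ ^ 2) ^ (1 - σ) := by positivity
  unfold modelFn
  linarith

lemma modelFn_le (hs : 1 ≤ s) (hsσ : s ≤ σ) (hx : ‖x‖ ≤ 1) :
    modelFn k s σ x ≤ 2 * ‖tailProj n k x‖ ^ s := by
  have h1 := Real.rpow_le_one_of_one_le_of_nonpos (one_le_two_sub_norm_sq (k := k) hx)
    (show 1 - σ ≤ 0 by linarith)
  have h2 : ‖tailProj n k x‖ ^ σ ≤ ‖tailProj n k x‖ ^ s :=
    Real.rpow_le_rpow_of_exponent_ge_of_imp (norm_nonneg _) ((norm_tailProj_le x).trans hx) hsσ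
      fun _ h => absurd h (by linarith)
  have h3 : 0 ≤ ‖tailProj n k x‖ ^ σ := by positivity
  unfold modelFn
  nlinarith

/-- A globally continuous function that agrees with the model subsolution in the closed ball. -/
lemma exists_continuous_eq_modelFn (k : ℕ) (hs : 1 ≤ s) (hsσ : s ≤ σ) :
    ∃ U : EuclideanSpace ℝ (Fin n) → ℝ, Continuous U ∧ (∀ x, 0 ≤ U x) ∧
      ∀ x, ‖x‖ ≤ 1 → U x = modelFn k s σ x := by
  refine ⟨fun x => ‖tailProj n k x‖ ^ s +
    ‖tailProj n k x‖ ^ σ * (max 1 (2 - ‖headProj n k x‖ ^ 2)) ^ (1 - σ), ?_, ?_, ?_⟩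
  · have ht : Continuous fun x : EuclideanSpace ℝ (Fin n) => ‖tailProj n k x‖ := by fun_prop
    have hr : Continuous fun x : EuclideanSpace ℝ (Fin n) =>
        max 1 (2 - ‖headProj n k x‖ ^ 2) := by fun_prop
    refine (ht.rpow_const fun x => Or.inr (by linarith)).add
      ((ht.rpow_const fun x => Or.inr (by linarith)).mul (hr.rpow_const fun x => Or.inl ?_))
    exact (one_pos.trans_le (le_max_left _ _)).ne'
  · intro x
    positivity
  · intro x hx
    change _ + _ * (max 1 _) ^ _ = _
    rw [max_eq_right (one_le_two_sub_norm_sq hx), modelFn]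

/-- A large multiple of the model subsolution is a strict subsolution, since the determinant scales
with a higher power (`n`) than the right-hand side (`q`). -/
lemma exists_modelFn_subsolution (hq0 : 0 ≤ q) (hqn : q < n) (hs : 1 ≤ s) (hσ : 1 < σ)
    (hsσ : s ≤ σ) (hk : 1 ≤ k) (hkn : k < n)
    (hexp : σ * ((k : ℝ) - 1) + (s - 2) * ((n : ℝ) - k - 1) + (2 * σ - 2) = s * q) :
    ∃ A : ℝ, 0 < A ∧ ∀ D : Set (EuclideanSpace ℝ (Fin n)), MeasurableSet D → D ⊆ ball 0 1 →
      2 * ∫⁻ x in D \ coordSubspace n k, ENNReal.ofReal ((A * modelFn k s σ x) ^ q) ≤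
        volume ((fun x => A • modelGrad k s σ x) '' (D \ coordSubspace n k)) := by
  set c := (2 * (σ - 1) * 2 ^ (-σ)) ^ (k - 1) * (2 * σ * (σ - 1) ^ 2 * 2 ^ (1 - 2 * σ)) with hc
  have hσ1 : 0 < σ - 1 := sub_pos.2 hσ
  have hσ0 : 0 < σ := one_pos.trans hσ
  have hc0 : 0 < c := by positivity
  have hnq : 0 < (n : ℝ) - q := sub_pos.2 hqn
  set A := (2 * 2 ^ q / c) ^ (1 / ((n : ℝ) - q)) with hA
  have hA0 : 0 < A := by positivity
  have hAn : A ^ n * c = 2 * 2 ^ q * A ^ q := by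
    have h1 : A ^ ((n : ℝ) - q) = 2 * 2 ^ q / c := by
      rw [hA, ← Real.rpow_mul (by positivity), one_div_mul_cancel hnq.ne', Real.rpow_one]
    have h2 : A ^ n = A ^ ((n : ℝ) - q) * A ^ q := by
      rw [← Real.rpow_natCast, ← Real.rpow_add hA0, sub_add_cancel]
    rw [h2, h1]
    field_simp
  refine ⟨A, hA0, fun D hD hDsub => ?_⟩
  have hclosed : IsClosed (coordSubspace n k : Set (EuclideanSpace ℝ (Fin n))) :=
    (coordSubspace n k).closed_of_finiteDimensional
  have hDS : MeasurableSet (D \ coordSubspace n k) := hD.diff hclosed.measurableSet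
  have hx1 : ∀ x ∈ D \ coordSubspace n k, ‖x‖ ≤ 1 := fun x hx =>
    (mem_ball_zero_iff.1 (hDsub hx.1)).le
  have hxt : ∀ x ∈ D \ coordSubspace n k, tailProj n k x ≠ 0 := fun x hx h =>
    hx.2 ((mem_coordSubspace_iff x).2 h)
  have hex : ∀ x : EuclideanSpace ℝ (Fin n), ∃ L, x ∈ D \ coordSubspace n k →
      HasFDerivAt (modelGrad (n := n) k s σ) L x ∧ c * ‖tailProj n k x‖ ^ (s * q) ≤ L.det := by
    intro x
    by_cases hx : x ∈ D \ coordSubspace n k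
    · obtain ⟨L, hL, hdet⟩ := exists_hasFDerivAt_le_det hs hσ (hx1 x hx) (hxt x hx) hk hkn
      rw [hexp] at hdet
      exact ⟨L, fun _ => ⟨hL, hdet⟩⟩
    · exact ⟨0, fun h => absurd h hx⟩
  choose L hL using hex
  rw [← lintegral_abs_det_fderiv_eq_addHaar_image volume
    (f := fun x => A • modelGrad k s σ x) (f' := fun x => A • L x) hDS
    (fun x hx => ((hL x hx).1.const_smul A).hasFDerivWithinAt) ?_,
    ← lintegral_const_mul' _ _ ENNReal.ofNat_ne_top]
  · refine setLIntegral_mono' hDS fun x hx => ?_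
    have hdet : (A • L x).det = A ^ n * (L x).det := by
      have := LinearMap.det_smul A
        (L x : EuclideanSpace ℝ (Fin n) →ₗ[ℝ] EuclideanSpace ℝ (Fin n))
      rwa [finrank_euclideanSpace_fin] at this
    have h2 : 2 * ENNReal.ofReal ((A * modelFn k s σ x) ^ q) =
        ENNReal.ofReal (2 * (A * modelFn k s σ x) ^ q) := by
      rw [ENNReal.ofReal_mul zero_le_two, ENNReal.ofReal_ofNat]
    rw [hdet, h2]
    refine ENNReal.ofReal_le_ofReal (le_trans ?_ (le_abs_self _))
    have ht : 0 ≤ ‖tailProj n k x‖ := norm_nonneg _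
    have hu0 : 0 ≤ modelFn k s σ x := le_trans (by positivity) (rpow_le_modelFn (hx1 x hx))
    calc 2 * (A * modelFn k s σ x) ^ q ≤ 2 * (A * (2 * ‖tailProj n k x‖ ^ s)) ^ q := by
          have := modelFn_le (k := k) hs hsσ (hx1 x hx)
          gcongr
      _ = A ^ n * (c * ‖tailProj n k x‖ ^ (s * q)) := by
          rw [Real.mul_rpow hA0.le (by positivity), Real.mul_rpow zero_le_two (by positivity),
            ← Real.rpow_mul ht, ← mul_assoc (A ^ n), hAn]
          ring
      _ ≤ A ^ n * (L x).det := by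
          have := (hL x hx).2
          gcongr
  · intro x hx y hy hxy
    refine injOn_modelGrad hs hσ ⟨mem_closedBall_zero_iff.2 (hx1 x hx), hx.2⟩
      ⟨mem_closedBall_zero_iff.2 (hx1 y hy), hy.2⟩ ?_
    exact smul_right_injective _ hA0.ne' hxy

end ModelSubsolution

/-! ### Coordinate subspaces -/

section CoordinateSubspace

variable {n k : ℕ}

lemma single_mem_coordSubspace (hn : 0 < n) (hk : 1 ≤ k) :
    EuclideanSpace.single (⟨0, hn⟩ : Fin n) (1 : ℝ) ∈ coordSubspace n k := by
  intro i hi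
  rw [PiLp.single_apply, if_neg]
  rintro rfl
  simp at hi
  omega

lemma coordSubspace_ne_top (hkn : k < n) : coordSubspace n k ≠ ⊤ := by
  intro h
  have h1 : EuclideanSpace.single (⟨k, hkn⟩ : Fin n) (1 : ℝ) ∈ coordSubspace n k := h ▸ trivial
  simpa using h1 ⟨k, hkn⟩ le_rfl

lemma volume_coordSubspace (hkn : k < n) :
    volume (coordSubspace n k : Set (EuclideanSpace ℝ (Fin n))) = 0 :=
  Measure.addHaar_submodule _ _ (coordSubspace_ne_top hkn)

lemma finrank_coordSubspace (hkn : k ≤ n) : Module.finrank ℝ (coordSubspace n k) = k := by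
  let f : coordSubspace n k →ₗ[ℝ] Fin k → ℝ :=
    { toFun := fun x i => (x : EuclideanSpace ℝ (Fin n)) (Fin.castLE hkn i)
      map_add' := fun _ _ => rfl
      map_smul' := fun _ _ => rfl }
  have hf : Function.Bijective f := by
    constructor
    · intro x y hxy
      ext i
      by_cases hi : (i : ℕ) < k
      · exact congrFun hxy ⟨i, hi⟩
      · rw [x.2 i (not_lt.1 hi), y.2 i (not_lt.1 hi)]
    · intro g
      refine ⟨⟨WithLp.toLp 2 fun i => if h : (i : ℕ) < k then g ⟨i, h⟩ else 0, fun i hi => ?_⟩, ?_⟩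
      · simp [not_lt.2 hi]
      · ext i
        exact dif_pos i.2
  rw [(LinearEquiv.ofBijective f hf).finrank_eq, Module.finrank_fin_fun]

end CoordinateSubspace

/-! ### Geometry of flat discs -/

section FlatDisc

variable {E : Type*} [NormedAddCommGroup E] [InnerProductSpace ℝ E] {W : Submodule ℝ E} {e : E}

lemma vectorSpan_inter_ball (W : Submodule ℝ E) :
    vectorSpan ℝ ((W : Set E) ∩ ball 0 1) = W := by
  refine le_antisymm ?_ fun w hw => ?_
  · rw [vectorSpan_def, Submodule.span_le]
    rintro _ ⟨x, hx, y, hy, rfl⟩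
    exact W.sub_mem hx.1 hy.1
  · have hc : 0 < (‖w‖ + 1)⁻¹ := by positivity
    have h1 : (‖w‖ + 1)⁻¹ • w ∈ (W : Set E) ∩ ball 0 1 := by
      refine ⟨W.smul_mem _ hw, mem_ball_zero_iff.2 ?_⟩
      rw [norm_smul, Real.norm_of_nonneg hc.le, inv_mul_lt_one₀ (by positivity)]
      linarith
    have h2 := vsub_mem_vectorSpan ℝ h1 ⟨W.zero_mem, mem_ball_self one_pos⟩
    rw [vsub_eq_sub, sub_zero] at h2
    exact (Submodule.smul_mem_iff _ hc.ne').1 h2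

/-- Each point of the disc is the midpoint of a segment in the disc. -/
lemma exposedPoints_inter_ball (he : e ∈ W) (he0 : e ≠ 0) :
    ((W : Set E) ∩ ball 0 1).exposedPoints ℝ = ∅ := by
  refine eq_empty_of_forall_notMem fun x hx => ?_
  obtain ⟨⟨hxW, hxb⟩, l, hl⟩ := hx
  have hcont : ContinuousAt (fun δ : ℝ => x + δ • e) 0 := by fun_prop
  have hev : ∀ᶠ δ : ℝ in 𝓝 0, x + δ • e ∈ ball 0 1 :=
    hcont.eventually_mem (isOpen_ball.mem_nhds (by simpa using hxb))
  obtain ⟨ε, hε, hball⟩ := Metric.eventually_nhds_iff_ball.1 hev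
  have hmem : ∀ δ : ℝ, |δ| < ε → x + δ • e ∈ (W : Set E) ∩ ball 0 1 := fun δ hδ =>
    ⟨W.add_mem hxW (W.smul_mem _ he), hball δ (by simpa using hδ)⟩
  have habs : |ε / 2| < ε := by rw [abs_of_pos (by positivity)]; linarith
  have h1 := hl _ (hmem (ε / 2) habs)
  have h2 := hl _ (hmem (-(ε / 2)) (by rwa [abs_neg]))
  simp only [map_add, map_smul, smul_eq_mul] at h1 h2
  have h3 := h1.2 (by linarith [h2.1])
  rw [add_eq_left, smul_eq_zero] at h3
  exact h3.elim (by positivity : ε / 2 ≠ 0) he0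

lemma inter_ball_closure_inter_sphere_nonempty (he : e ∈ W) (he1 : ‖e‖ = 1) :
    (closure ((W : Set E) ∩ ball 0 1) ∩ sphere 0 1).Nonempty := by
  refine ⟨e, ?_, mem_sphere_zero_iff_norm.2 he1⟩
  have hlim : Tendsto (fun m : ℕ => (1 - 1 / ((m : ℝ) + 1)) • e) atTop (𝓝 e) := by
    have := (tendsto_one_div_add_atTop_nhds_zero_nat (𝕜 := ℝ)).const_sub 1
    simpa using this.smul_const e
  refine mem_closure_of_tendsto hlim (Eventually.of_forall fun m => ⟨W.smul_mem _ he, ?_⟩)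
  have h1 : 0 < 1 / ((m : ℝ) + 1) := by positivity
  have h2 : 1 / ((m : ℝ) + 1) ≤ 1 := by
    rw [div_le_one (by positivity)]
    linarith [(Nat.cast_nonneg m : (0 : ℝ) ≤ m)]
  rw [mem_ball_zero_iff, norm_smul, he1, mul_one, Real.norm_of_nonneg (by linarith)]
  linarith

/-- A linear functional does not decrease when a point of the ball is moved to the sphere in one of
the two directions along a given line. -/
lemma exists_add_smul_mem_sphere (he1 : ‖e‖ = 1) {x : E} (hx : ‖x‖ ≤ 1) (p : E) :
    ∃ a : ℝ, x + a • e ∈ sphere 0 1 ∧ ⟪p, x⟫ ≤ ⟪p, x + a • e⟫ := by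
  have key : ∀ e : E, ‖e‖ = 1 → 0 ≤ ⟪p, e⟫ →
      ∃ a : ℝ, x + a • e ∈ sphere 0 1 ∧ ⟪p, x⟫ ≤ ⟪p, x + a • e⟫ := by
    intro e he1 hpe
    have hx2 : 0 ≤ 1 - ‖x‖ ^ 2 := by nlinarith [norm_nonneg x]
    have hsq := Real.sq_sqrt (show 0 ≤ ⟪x, e⟫ ^ 2 + (1 - ‖x‖ ^ 2) by positivity)
    have hle : ⟪x, e⟫ ≤ √(⟪x, e⟫ ^ 2 + (1 - ‖x‖ ^ 2)) := Real.le_sqrt_of_sq_le (by linarith)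
    refine ⟨-⟪x, e⟫ + √(⟪x, e⟫ ^ 2 + (1 - ‖x‖ ^ 2)), ?_, ?_⟩
    · rw [mem_sphere_zero_iff_norm, ← sq_eq_sq₀ (norm_nonneg _) zero_le_one, norm_add_sq_real,
        inner_smul_right, norm_smul, he1, mul_one, Real.norm_eq_abs, sq_abs]
      linear_combination hsq
    · rw [inner_add_right, inner_smul_right]
      have : 0 ≤ -⟪x, e⟫ + √(⟪x, e⟫ ^ 2 + (1 - ‖x‖ ^ 2)) := by linarith
      have := mul_nonneg this hpe
      linarith
  rcases le_total 0 ⟪p, e⟫ with h | h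
  · exact key e he1 h
  · obtain ⟨a, ha⟩ := key (-e) (by rwa [norm_neg]) (by rw [inner_neg_right]; linarith)
    exact ⟨-a, by rwa [neg_smul, ← smul_neg]⟩

end FlatDisc

/-! ### The boundary values -/

section BoundaryDatum

variable {n k : ℕ} {s : ℝ}

lemma exists_supporting_norm_tailProj_rpow (hs : 1 ≤ s) (y : EuclideanSpace ℝ (Fin n)) :
    ∃ p₀, ∀ z, ‖tailProj n k y‖ ^ s + ⟪p₀, z - y⟫ ≤ ‖tailProj n k z‖ ^ s := by
  by_cases hy : tailProj n k y = 0
  · refine ⟨0, fun z => ?_⟩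
    rw [hy, norm_zero, Real.zero_rpow (by linarith), inner_zero_left, add_zero]
    positivity
  · have ha : 0 < ‖tailProj n k y‖ := norm_pos_iff.2 hy
    refine ⟨(s * ‖tailProj n k y‖ ^ (s - 1) * ‖tailProj n k y‖⁻¹) • tailProj n k y, fun z => ?_⟩
    refine le_trans ?_ (rpow_tangent_le ha (norm_nonneg (tailProj n k z)) hs)
    rw [real_inner_smul_left, ← inner_tailProj_tailProj, map_sub, inner_sub_right,
      real_inner_self_eq_norm_sq, mul_assoc (s * _)]
    have h1 := real_inner_le_norm (tailProj n k y) (tailProj n k z)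
    have h2 : ‖tailProj n k y‖⁻¹ * (⟪tailProj n k y, tailProj n k z⟫ - ‖tailProj n k y‖ ^ 2) ≤
        ‖tailProj n k z‖ - ‖tailProj n k y‖ := by
      rw [inv_mul_le_iff₀ ha]
      linarith
    have h3 : 0 ≤ s * ‖tailProj n k y‖ ^ (s - 1) := by positivity
    have h4 := mul_le_mul_of_nonneg_left h2 h3
    linarith

end BoundaryDatum

/-! ### The solution -/

/-- A convex function on the closed ball that solves the equation without the characteristic
function in the ball and is trapped between two multiples of `dist(·, ℝᵏ) ^ s`. -/
lemma exists_solution_between (n : ℕ) (q : ℝ) (hq0 : 0 ≤ q) (hqn : q < n) (k : ℕ) (hk1 : 1 ≤ k)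
    (hk : (k : ℝ) < ((n : ℝ) + q) / 2) (s : ℝ)
    (hs : s ∈ Set.Icc (1 : ℝ) ((2 * (n : ℝ) - 2 * (k : ℝ)) / ((n : ℝ) - q))) :
    ∃ (v : EuclideanSpace ℝ (Fin n) → ℝ) (A : ℝ), 0 < A ∧ ConvexOn ℝ (closedBall 0 1) v ∧
      ContinuousOn v (closedBall 0 1) ∧
      (∀ x ∈ closedBall 0 1, A * ‖tailProj n k x‖ ^ s ≤ v x) ∧
      (∀ x ∈ closedBall 0 1, v x ≤ 2 * A * ‖tailProj n k x‖ ^ s) ∧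
      ∀ D : Set (EuclideanSpace ℝ (Fin n)), MeasurableSet D → D ⊆ ball 0 1 →
        mongeAmpereMeasure (ball 0 1) v D = ∫⁻ x in D, ENNReal.ofReal (v x ^ q) := by
  obtain ⟨hs1, hs2⟩ := hs
  have hkn : k < n := by
    have : (k : ℝ) < n := by linarith
    exact_mod_cast this
  have hn : 0 < n := by omega
  have : Nonempty (Fin n) := ⟨⟨0, hn⟩⟩
  have hnq : 0 < (n : ℝ) - q := sub_pos.2 hqn
  have hexcess : 0 ≤ 2 * ((n : ℝ) - k) - s * (n - q) := by
    rw [le_div_iff₀ hnq] at hs2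
    linarith
  -- the exponent for which the determinant of the model Hessian is comparable to `t ^ (s * q)`
  set σ : ℝ := s + (2 * ((n : ℝ) - k) - s * (n - q)) / (k + 1) with hσdef
  have hk0 : (0 : ℝ) < k + 1 := by positivity
  have hsσ : s ≤ σ := le_add_of_nonneg_right (by positivity)
  have hσ : 1 < σ := by
    rcases hs1.eq_or_lt with h | h
    · rw [hσdef, ← h]
      have : 0 < (2 * ((n : ℝ) - k) - 1 * (n - q)) / (k + 1) := div_pos (by linarith) hk0
      linarith
    · linarith
  have hexp : σ * ((k : ℝ) - 1) + (s - 2) * ((n : ℝ) - k - 1) + (2 * σ - 2) = s * q := by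
    rw [hσdef]
    field_simp
    ring
  obtain ⟨A, hA, hAsub⟩ := exists_modelFn_subsolution hq0 hqn hs1 hσ hsσ hk1 hkn hexp
  obtain ⟨U, hUcont, hU0, hUeq⟩ := exists_continuous_eq_modelFn (n := n) k hs1 hsσ
  have hUle : ∀ x : EuclideanSpace ℝ (Fin n), ‖x‖ ≤ 1 → U x ≤ 2 * ‖tailProj n k x‖ ^ s :=
    fun x hx => (hUeq x hx).trans_le (modelFn_le hs1 hsσ hx)
  have htail : ∀ x : EuclideanSpace ℝ (Fin n), ‖x‖ ≤ 1 → ‖tailProj n k x‖ ^ s ≤ 1 := fun x hx =>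
    Real.rpow_le_one (norm_nonneg _) ((norm_tailProj_le x).trans hx) (by linarith)
  have hφcont : Continuous fun x : EuclideanSpace ℝ (Fin n) => 2 * A * ‖tailProj n k x‖ ^ s := by
    have ht : Continuous fun x : EuclideanSpace ℝ (Fin n) => ‖tailProj n k x‖ := by fun_prop
    exact (ht.rpow_const fun x => Or.inr (by linarith)).const_mul _
  -- truncating `h` from below by the subsolution keeps the right-hand side from degenerating
  obtain ⟨v, hvconv, hvcont, hvle, hvge, hvMA⟩ := exists_mongeAmpereMeasure_eq
    (φ := fun x : EuclideanSpace ℝ (Fin n) => 2 * A * ‖tailProj n k x‖ ^ s)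
    (f := fun x h => (max h (A * U x)) ^ q) (B := (2 * A) ^ q) (C := 2 * A)
    hφcont.continuousOn (fun z _ => by positivity)
    (fun z hz => by
      have := htail z (mem_closedBall_zero_iff.1 hz)
      nlinarith)
    (fun y _ => by
      obtain ⟨p, hp⟩ := exists_supporting_norm_tailProj_rpow (k := k) hs1 y
      refine ⟨(2 * A) • p, fun z _ => ?_⟩
      have := mul_le_mul_of_nonneg_left (hp z) (show 0 ≤ 2 * A by positivity)
      rw [real_inner_smul_left]
      simpa [mul_add] using this)
    (fun x hx p => by
      have he := single_mem_coordSubspace hn hk1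
      obtain ⟨a, haz, hap⟩ := exists_add_smul_mem_sphere
        (e := EuclideanSpace.single (⟨0, hn⟩ : Fin n) (1 : ℝ)) (by simp)
        (mem_closedBall_zero_iff.1 hx) p
      refine ⟨_, haz, ?_⟩
      rw [map_add, map_smul, (mem_coordSubspace_iff _).1 he, smul_zero, add_zero]
      linarith)
    (by
      refine Continuous.rpow_const ?_ fun _ => Or.inr hq0
      exact continuous_snd.max (continuous_const.mul (hUcont.comp continuous_fst)))
    (fun x h => Real.rpow_nonneg (le_max_of_le_right (mul_nonneg hA.le (hU0 x))) _)
    (fun x hx h hh => by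
      have hx1 := (mem_ball_zero_iff.1 hx).le
      have h1 := hUle x hx1
      have h2 := htail x hx1
      refine Real.rpow_le_rpow (le_max_of_le_right (mul_nonneg hA.le (hU0 x)))
        (max_le hh ?_) hq0
      nlinarith)
  have hW : IsClosed (coordSubspace n k : Set (EuclideanSpace ℝ (Fin n))) :=
    (coordSubspace n k).closed_of_finiteDimensional
  have hcomp : ∀ x ∈ closedBall 0 1, A * U x ≤ v x := by
    refine le_of_strict_subsolution (S := coordSubspace n k) (G := fun x => A • modelGrad k s σ x)
      (F := fun x => (A * U x) ^ q) (B := (2 * A) ^ q) (hUcont.const_mul A).continuousOn hvcont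
      (fun x hx => ?_) hW (volume_coordSubspace hkn) (fun x hx y hy => ?_) (fun x hx => ?_)
      (fun x hx => ?_) ?_ (fun D hD hDsub => ?_) (fun D hD hDsub hlt => ?_)
    · refine le_trans ?_ (hvge x hx)
      have := hUle x (mem_sphere_zero_iff_norm.1 hx).le
      nlinarith
    · have hx1 := (mem_ball_zero_iff.1 hx.1).le
      have hy1 := mem_closedBall_zero_iff.1 hy
      have h1 : modelFn k s σ x + ⟪modelGrad k s σ x, y - x⟫ ≤ modelFn k s σ y := by
        rcases eq_or_ne y x with rfl | hyx
        · simp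
        · exact (modelFn_tangent_lt hs1 hσ hx1 hy1 hx.2 hyx).le
      have h2 := mul_le_mul_of_nonneg_left h1 hA.le
      rw [hUeq x hx1, hUeq y hy1, real_inner_smul_left]
      simpa [mul_add] using h2
    · have hx1 := (mem_ball_zero_iff.1 hx.1).le
      have h1 : 0 < ‖tailProj n k x‖ :=
        norm_pos_iff.2 fun h => hx.2 ((mem_coordSubspace_iff x).2 h)
      have h2 : 0 < U x := by
        rw [hUeq x hx1]
        exact (Real.rpow_pos_of_pos h1 s).trans_le (rpow_le_modelFn hx1)
      positivity
    · have hx1 := (mem_ball_zero_iff.1 hx).le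
      have h1 := hUle x hx1
      have h2 := htail x hx1
      exact Real.rpow_le_rpow (mul_nonneg hA.le (hU0 x)) (by nlinarith) hq0
    · exact ((hUcont.const_mul A).rpow_const fun _ => Or.inr hq0).measurable
    · refine le_trans (le_of_eq ?_) (hAsub D hD.measurableSet hDsub)
      congr 1
      refine setLIntegral_congr_fun (hD.measurableSet.diff hW.measurableSet) fun x hx => ?_
      rw [hUeq x (mem_ball_zero_iff.1 (hDsub hx.1)).le]
    · rw [hvMA D hD hDsub]
      refine (setLIntegral_congr_fun hD fun x hx => ?_).le
      rw [max_eq_right (hlt x hx).le]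
  refine ⟨v, A, hA, hvconv, hvcont, fun x hx => le_trans ?_ (hcomp x hx), hvle,
    fun D hD hDsub => ?_⟩
  · have hx1 := mem_closedBall_zero_iff.1 hx
    rw [hUeq x hx1]
    exact mul_le_mul_of_nonneg_left (rpow_le_modelFn hx1) hA.le
  · rw [hvMA D hD hDsub]
    refine setLIntegral_congr_fun hD fun x hx => ?_
    rw [max_eq_left (hcomp x (ball_subset_closedBall (hDsub hx)))]

theorem theorem1p2 (n : ℕ) (q : ℝ) (hq0 : 0 ≤ q) (hqn : q < n) (hnq : 2 < (n : ℝ) + q)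
    (k : ℕ) (hk1 : 1 ≤ k) (hk : (k : ℝ) < ((n : ℝ) + q) / 2)
    (s : ℝ) (hs : s ∈ Set.Icc (1 : ℝ) ((2 * (n : ℝ) - 2 * (k : ℝ)) / ((n : ℝ) - q))) :
    ∃ v : EuclideanSpace ℝ (Fin n) → ℝ,
      -- `v` solves the obstacle problem in the unit ball, with `K = ℝᵏ ∩ B₁`
      IsObstacleSolution q (Metric.ball 0 1) v ∧
      coincidenceSet (Metric.ball 0 1) v =
        (coordSubspace n k : Set (EuclideanSpace ℝ (Fin n))) ∩ Metric.ball 0 1 ∧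
      -- `v` is comparable to the power `s` of the distance to `ℝᵏ`
      (∃ c C : ℝ, 0 < c ∧ 0 < C ∧ ∀ x ∈ Metric.ball (0 : EuclideanSpace ℝ (Fin n)) 1,
        c * Metric.infDist x (coordSubspace n k) ^ s ≤ v x ∧
          v x ≤ C * Metric.infDist x (coordSubspace n k) ^ s) ∧
      -- sharpness: `K` is a `k`-dimensional convex subset of the non-strictly convex part of the
      -- free boundary, and `v` is continuous up to the sphere with growth of order `s` there
      Convex ℝ (coincidenceSet (Metric.ball 0 1) v) ∧
      coincidenceSet (Metric.ball 0 1) v ⊆ nonStrictlyConvexPart (Metric.ball 0 1) v ∧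
      Module.finrank ℝ (vectorSpan ℝ (coincidenceSet (Metric.ball 0 1) v)) = k ∧
      ContinuousOn v (Metric.closedBall 0 1) ∧
      (closure (coincidenceSet (Metric.ball 0 1) v) ∩ Metric.sphere 0 1).Nonempty ∧
      ∀ x₀ ∈ closure (coincidenceSet (Metric.ball 0 1) v) ∩ Metric.sphere 0 1,
        ∃ C' : ℝ, 0 < C' ∧ ∀ x ∈ Metric.sphere (0 : EuclideanSpace ℝ (Fin n)) 1,
          v x ≤ C' * ‖x - x₀‖ ^ s := by
  have hkn : k < n := by
    have : (k : ℝ) < n := by linarith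
    exact_mod_cast this
  have hn : 0 < n := by omega
  have hs0 : 0 < s := one_pos.trans_le hs.1
  obtain ⟨v, A, hA, hconv, hcont, hlow, hupp, hMA⟩ :=
    exists_solution_between n q hq0 hqn k hk1 hk s hs
  have hsub : ball (0 : EuclideanSpace ℝ (Fin n)) 1 ⊆ closedBall 0 1 := ball_subset_closedBall
  have hv0 : ∀ x ∈ closedBall 0 1, 0 ≤ v x := fun x hx => le_trans (by positivity) (hlow x hx)
  have hzero : ∀ x ∈ ball 0 1, v x = 0 ↔ x ∈ coordSubspace n k := by
    intro x hx
    rw [mem_coordSubspace_iff]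
    constructor
    · intro h
      by_contra hne
      have h1 : 0 < ‖tailProj n k x‖ := norm_pos_iff.2 hne
      have h2 := hlow x (hsub hx)
      rw [h] at h2
      exact absurd h2 (not_le.2 (by positivity))
    · intro h
      have h2 := hupp x (hsub hx)
      rw [h, norm_zero, Real.zero_rpow hs0.ne', mul_zero] at h2
      exact le_antisymm h2 (hv0 x (hsub hx))
  set W := coordSubspace n k with hW
  have hWclosed : IsClosed (W : Set (EuclideanSpace ℝ (Fin n))) := W.closed_of_finiteDimensional
  have hWnull : volume (W : Set (EuclideanSpace ℝ (Fin n))) = 0 := volume_coordSubspace hkn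
  have hK : coincidenceSet (ball 0 1) v = (W : Set (EuclideanSpace ℝ (Fin n))) ∩ ball 0 1 := by
    ext x
    exact ⟨fun hx => ⟨(hzero x hx.1).1 hx.2, hx.1⟩, fun hx => ⟨hx.2, (hzero x hx.2).2 hx.1⟩⟩
  have he : EuclideanSpace.single (⟨0, hn⟩ : Fin n) (1 : ℝ) ∈ W := single_mem_coordSubspace hn hk1
  have he1 : ‖EuclideanSpace.single (⟨0, hn⟩ : Fin n) (1 : ℝ)‖ = 1 := by simp
  refine ⟨v, ⟨hconv.subset hsub (convex_ball _ _), fun x hx => hv0 x (hsub hx),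
    fun D hD hDsub => ?_⟩, hK, ⟨A, 2 * A, hA, by positivity, fun x hx => ?_⟩,
    ?_, ?_, ?_, hcont, ?_, fun x₀ hx₀ => ?_⟩
  · rw [hMA D hD hDsub]
    refine lintegral_congr_ae ?_
    have hne : ∀ᵐ x ∂volume.restrict D, x ∉ (W : Set (EuclideanSpace ℝ (Fin n))) :=
      ae_restrict_of_ae (measure_eq_zero_iff_ae_notMem.1 hWnull)
    filter_upwards [hne, ae_restrict_mem hD] with x hxW hxD
    have hx := hDsub hxD
    have hpos : 0 < v x := (hv0 x (hsub hx)).lt_of_ne fun h => hxW ((hzero x hx).1 h.symm)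
    rw [indicator_of_mem (show x ∈ {x | 0 < v x} from hpos)]
  · rw [infDist_coordSubspace]
    exact ⟨hlow x (hsub hx), hupp x (hsub hx)⟩
  · rw [hK]
    exact W.convex.inter (convex_ball _ _)
  · rw [nonStrictlyConvexPart, hK, exposedPoints_inter_ball he (norm_ne_zero_iff.1 (by simp)),
      sdiff_empty]
    have hint : interior ((W : Set (EuclideanSpace ℝ (Fin n))) ∩ ball 0 1) = ∅ :=
      Measure.interior_eq_empty_of_null (μ := volume) (measure_mono_null inter_subset_left hWnull)
    rw [frontier, hint, sdiff_empty]
    exact fun x hx => ⟨hx.2, subset_closure hx⟩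
  · rw [hK, vectorSpan_inter_ball]
    exact finrank_coordSubspace hkn.le
  · rw [hK]
    exact inter_ball_closure_inter_sphere_nonempty he he1
  · rw [hK] at hx₀
    have hx₀W : x₀ ∈ W :=
      hWclosed.closure_subset (closure_mono inter_subset_left hx₀.1)
    refine ⟨2 * A, by positivity, fun x hx => (hupp x (sphere_subset_closedBall hx)).trans ?_⟩
    have h1 : ‖tailProj n k x‖ ≤ ‖x - x₀‖ := by
      have h2 := norm_tailProj_le (k := k) (x - x₀)
      rwa [map_sub, (mem_coordSubspace_iff x₀).1 hx₀W, sub_zero] at h2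
    gcongr
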